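/- Let $d \ge 2$ be an integer. Let $\mathbb{S}^d$ be the unit sphere in $\mathbb{R}^{d+1}$ and $\mathbb{B}^d$ the unit ball in $\mathbb{R}^d$. Let $\mathcal{H}_d$ denote $d$-dimensional Hausdorff measure, normalized so that a $d$-dimensional cube of side length $1$ has measure $1$, and put $$F_d := \frac{\mathcal{H}_d(\mathbb{B}^d)}{\mathcal{H}_d(\mathbb{S}^d)} .$$ For $N \ge 2$ let $$\mathcal{E}_d(\mathbb{S}^d;N) := \min\Big\{ \sum_{j \neq k} \frac{1}{|x_j - x_k|^{d}} \;:\; x_1,\dots,x_N \in \mathbb{S}^d \Big\}$$ be the minimal $N$-point Riesz $d$-energy of $\mathbb{S}^d$, where the sum runs over ordered pairs $(j,k)$ with $1\le j,k\le N$, $j\ne k$, and a pair of coinciding points contributes $+\infty$ (the minimum is attained and finite). Let $\psi = \Gamma'/\Gamma$ be the digamma function and put $$c(d) := F_d \left\{ 1 - \log F_d + d\left[ \psi(d/2) - \psi(1) - \log 2 \right] \right\} .$$ Then $c(d) > 0$ and, as $N \to \infty$ with $d$ fixed, $$- c(d)\, N^2 + \mathcal{O}\big(N^{2-2/d} \log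 N\big) \;\le\; \mathcal{E}_d(\mathbb{S}^d;N) - F_d\, N^2 \log N \;\le\; F_d\, N^2 \log\log N + \mathcal{O}(N^2),$$ where the implied constants may depend on $d$. -/

import Mathlib

open MeasureTheory Filter Asymptotics
open scoped ENNReal

noncomputable section

/-- The Riesz `s`-energy `∑_{j ≠ k} 1 / |x_j - x_k|^s` of a configuration of `N` points, over ordered
pairs, for `s > 0`. It is `[0, ∞]`-valued: coinciding points contribute `1 / 0 = ∞`. -/
def rieszEnergy {X : Type*} [PseudoEMetricSpace X] (s : ℝ) {N : ℕ} (x : Fin N → X) : ℝ≥0∞ :=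
  ∑ p ∈ (Finset.univ : Finset (Fin N)).offDiag, (edist (x p.1) (x p.2) ^ s)⁻¹

/-- The minimal `N`-point Riesz `s`-energy of a set `A`, for `s > 0`. -/
def minRieszEnergy {X : Type*} [PseudoEMetricSpace X] (s : ℝ) (A : Set X) (N : ℕ) : ℝ≥0∞ :=
  ⨅ x : Fin N → A, rieszEnergy s (fun j => (x j : X))

/-- The unit sphere `𝕊^d` in `ℝ^{d+1}`. -/
def unitSphere (d : ℕ) : Set (EuclideanSpace ℝ (Fin (d + 1))) := Metric.sphere 0 1

/-- The unit ball `𝔹^d` in `ℝ^d`. -/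
def unitBall (d : ℕ) : Set (EuclideanSpace ℝ (Fin d)) := Metric.closedBall 0 1

/-- The ratio `H_d(𝔹^d) / H_d(𝕊^d)`, with the `d`-dimensional Hausdorff measure normalized so that
the unit cube of `ℝ^d` has measure one. -/
def ballSphereRatio (d : ℕ) : ℝ :=
  (μHE[d] (unitBall d)).toReal / (μHE[d] (unitSphere d)).toReal

/-- The digamma function `Γ' / Γ` at a real argument. -/
def realDigamma (x : ℝ) : ℝ := (Complex.digamma (x : ℂ)).re

/-- The constant `c(d) = F_d {1 - log F_d + d [ψ(d/2) - ψ(1) - log 2]}`. -/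
def secondOrderConstant (d : ℕ) : ℝ :=
  ballSphereRatio d *
    (1 - Real.log (ballSphereRatio d) +
      (d : ℝ) * (realDigamma ((d : ℝ) / 2) - realDigamma 1 - Real.log 2))

end

/-! Both bounds use the law of the height `⟪x, p⟫` for the uniform probability measure on the
sphere. Its density is `capConst d * (1 - t²)^(d/2 - 1)` for every pole `p`, and `F_d = capConst d /
d` (`ballSphereRatio_eq`).

Lower bound. For `ε > 0`, replace the kernel `|x - y|^(-d) = (2 - 2t)^(-d/2)` by the smaller kernel
`(2 + ε - 2t)^(-d/2)`. Its power series in `t = ⟪x, y⟫` has nonnegative coefficients, and each `t^n`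
is a positive definite kernel. Hence its sum over all pairs, diagonal included, is at least `N²`
times its mean (`sq_mul_integral_mollified_le_sum`). The diagonal costs `N ε^(-d/2)`. The mean is at
least `(d F_d / 2)(-log (ε/4) - 2(ψ(d/2) - ψ(1)))`, by `le_integral_mollifiedIntegrand`. The optimal
`ε`, given by `ε^(-d/2) = F_d N`, produces exactly `F_d N² log N - c(d) N²`, with no error term.

Upper bound. Points are added greedily. Balls of radius `r` around the earlier points cover a
proportion at most `δ` of the sphere, and off such a ball the kernel has integral at most `d F_d log
(2/r)`. Some point of the remaining set therefore has potential at most the average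
(`exists_sum_inv_edist_le`). Taking `r^d = 1 / (N log N)` produces the `log log N` term.

Positivity of `c(d)` follows from `F_d ≤ 1/2` and the recursion of the digamma function in steps of
two in `d`. -/

/-! ### Height integrals against the projected Lebesgue measure of the ball -/

/-- The weight `(1 - t²)^(d/2 - 1)`. -/
noncomputable def capWeight (d : ℕ) (t : ℝ) : ℝ := (1 - t ^ 2) ^ ((d : ℝ) / 2 - 1)

theorem exists_lintegral_fun_norm (d : ℕ) (hd : 1 ≤ d) :
    ∃ κ : ℝ≥0∞, κ ≠ 0 ∧ κ ≠ ⊤ ∧ ∀ g : ℝ → ℝ≥0∞, Measurable g →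
      ∫⁻ z : EuclideanSpace ℝ (Fin d), g ‖z‖ =
        κ * ∫⁻ r in Set.Ioi (0 : ℝ), ENNReal.ofReal (r ^ (d - 1)) * g r := by
  set W := EuclideanSpace ℝ (Fin d)
  have : Nontrivial W := by
    have : Nonempty (Fin d) := ⟨⟨0, hd⟩⟩
    infer_instance
  set μ : Measure W := volume
  refine ⟨μ.toSphere Set.univ, ?_, by finiteness, fun g hg => ?_⟩
  · rw [Measure.toSphere_apply_univ]
    simp only [ne_eq, mul_eq_zero, not_or]
    refine ⟨by simp [W]; omega, (Metric.measure_ball_pos μ 0 one_pos).ne'⟩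
  calc ∫⁻ z, g ‖z‖ ∂μ = ∫⁻ z : ({(0)}ᶜ : Set W), g ‖z.1‖ ∂(μ.comap (↑)) := by
        rw [lintegral_subtype_comap (measurableSet_singleton _).compl fun x ↦ g (‖x‖),
          restrict_compl_singleton]
    _ = ∫⁻ x, g x.2 ∂μ.toSphere.prod (.volumeIoiPow (Module.finrank ℝ W - 1)) := by
        simpa using μ.measurePreserving_homeomorphUnitSphereProd.lintegral_comp_emb
          (Homeomorph.measurableEmbedding _) (g ∘ Subtype.val ∘ Prod.snd)
    _ = _ := by
        have hm : Measurable fun y : Set.Ioi (0 : ℝ) => g y := hg.comp measurable_subtype_coe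
        have := lintegral_prod_mul (μ := μ.toSphere) (ν := .volumeIoiPow (Module.finrank ℝ W - 1))
          (f := fun _ => 1) (g := fun y : Set.Ioi (0 : ℝ) => g y) aemeasurable_const hm.aemeasurable
        simp only [one_mul, lintegral_const] at this
        rw [this, Measure.volumeIoiPow, lintegral_withDensity_eq_lintegral_mul _ (by fun_prop) hm]
        congr 1
        rw [← lintegral_subtype_comap measurableSet_Ioi]
        simp [W]

/-- Any isometry between the two spaces can be corrected by the reflection exchanging two vectors of
equal norm. Coordinates adapted to `p` replace an appeal to rotation invariance. -/
theorem exists_isometryEquiv_pole (d : ℕ) (p : EuclideanSpace ℝ (Fin (d + 1))) (hp : ‖p‖ = 1) :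
    ∃ Φ : WithLp 2 (ℝ × EuclideanSpace ℝ (Fin d)) ≃ₗᵢ[ℝ] EuclideanSpace ℝ (Fin (d + 1)),
      Φ (WithLp.toLp 2 (1, 0)) = p := by
  have hfr : Module.finrank ℝ (WithLp 2 (ℝ × EuclideanSpace ℝ (Fin d))) = d + 1 := by
    rw [(WithLp.linearEquiv 2 ℝ (ℝ × EuclideanSpace ℝ (Fin d))).finrank_eq]
    simp [add_comm]
  let Ψ := ((stdOrthonormalBasis ℝ (WithLp 2 (ℝ × EuclideanSpace ℝ (Fin d)))).reindex
    (finCongr hfr)).repr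
  let v := Ψ (WithLp.toLp 2 (1, 0))
  have hv : ‖v‖ = ‖p‖ := by
    rw [hp, LinearIsometryEquiv.norm_map, WithLp.prod_norm_eq_of_L2]; simp
  exact ⟨Ψ.trans ((ℝ ∙ (v - p))ᗮ.reflection), Submodule.reflection_sub hv⟩

theorem inner_pole {d : ℕ} {p : EuclideanSpace ℝ (Fin (d + 1))}
    {Φ : WithLp 2 (ℝ × EuclideanSpace ℝ (Fin d)) ≃ₗᵢ[ℝ] EuclideanSpace ℝ (Fin (d + 1))}
    (hΦ : Φ (WithLp.toLp 2 (1, 0)) = p) (s : ℝ) (z : EuclideanSpace ℝ (Fin d)) :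
    inner ℝ (Φ (WithLp.toLp 2 (s, z))) p = s := by
  rw [← hΦ, LinearIsometryEquiv.inner_map_map]
  simp

theorem norm_pole {d : ℕ}
    (Φ : WithLp 2 (ℝ × EuclideanSpace ℝ (Fin d)) ≃ₗᵢ[ℝ] EuclideanSpace ℝ (Fin (d + 1)))
    (s : ℝ) (z : EuclideanSpace ℝ (Fin d)) :
    ‖Φ (WithLp.toLp 2 (s, z))‖ = √(s ^ 2 + ‖z‖ ^ 2) := by
  rw [LinearIsometryEquiv.norm_map, WithLp.prod_norm_eq_of_L2]; simp

/-- The push-forward of Lebesgue measure on the unit ball under radial projection. -/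
noncomputable def coneMeasure (d : ℕ) : Measure (EuclideanSpace ℝ (Fin (d + 1))) :=
  (volume.restrict (Metric.ball 0 1)).map fun x => ‖x‖⁻¹ • x

theorem lintegral_cos_eq (d : ℕ) (hd : 2 ≤ d) (f : ℝ → ℝ≥0∞) :
    ∫⁻ θ in Set.Ioo 0 Real.pi, ENNReal.ofReal (Real.sin θ ^ (d - 1)) * f (Real.cos θ) =
      ∫⁻ t in Set.Ioo (-1) 1, f t * ENNReal.ofReal (capWeight d t) := by
  have himg : Real.cos '' Set.Ioo 0 Real.pi = Set.Ioo (-1) 1 := by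
    ext t; constructor
    · rintro ⟨θ, ⟨h0, h1⟩, rfl⟩
      constructor
      · rw [← Real.cos_pi]; exact Real.strictAntiOn_cos ⟨h0.le, h1.le⟩ ⟨Real.pi_pos.le, le_rfl⟩ h1
      · rw [← Real.cos_zero]; exact Real.strictAntiOn_cos ⟨le_rfl, Real.pi_pos.le⟩ ⟨h0.le, h1.le⟩ h0
    · rintro ⟨h0, h1⟩
      refine ⟨Real.arccos t, ⟨Real.arccos_pos.2 h1, ?_⟩, Real.cos_arccos h0.le h1.le⟩
      refine lt_of_le_of_ne (Real.arccos_le_pi t) fun h => ?_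
      rw [Real.arccos_eq_pi] at h; linarith
  rw [← himg, lintegral_image_eq_lintegral_abs_deriv_mul measurableSet_Ioo
    (fun θ _ => (Real.hasDerivAt_cos θ).hasDerivWithinAt)
    (Real.injOn_cos.mono Set.Ioo_subset_Icc_self)]
  refine setLIntegral_congr_fun measurableSet_Ioo fun θ hθ => ?_
  have hs : 0 < Real.sin θ := Real.sin_pos_of_mem_Ioo hθ
  have hw : capWeight d (Real.cos θ) = Real.sin θ ^ (d - 2) := by
    rw [capWeight, ← Real.sin_sq, ← Real.rpow_natCast, ← Real.rpow_natCast, ← Real.rpow_mul hs.le]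
    congr 1
    push_cast [Nat.cast_sub hd]
    ring
  simp only [abs_neg, abs_of_pos hs, hw]
  rw [show d - 1 = (d - 2) + 1 by omega, pow_succ', ENNReal.ofReal_mul hs.le]
  ring

/-- In coordinates (height `s`, horizontal part `z`) the integrand depends only on `s` and `‖z‖`.
Radial integration in `z` followed by polar coordinates in the half-plane `r > 0` separates the
radius from the angle, and `t = cos θ` gives the weight. The constant `C` does not depend on the
pole. -/
theorem exists_lintegral_coneMeasure (d : ℕ) (hd : 2 ≤ d) :
    ∃ C : ℝ≥0∞, C ≠ 0 ∧ C ≠ ⊤ ∧ ∀ p : EuclideanSpace ℝ (Fin (d + 1)), ‖p‖ = 1 →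
      ∀ f : ℝ → ℝ≥0∞, Measurable f → ∫⁻ x, f (inner ℝ x p) ∂coneMeasure d =
        C * ∫⁻ t in Set.Ioo (-1) 1, f t * ENNReal.ofReal (capWeight d t) := by
  obtain ⟨κ, hκ0, hκ, hrad⟩ := exists_lintegral_fun_norm d (by omega)
  refine ⟨κ * ∫⁻ ρ in Set.Ioi (0 : ℝ), (Set.Iio 1).indicator (fun ρ => ENNReal.ofReal (ρ ^ d)) ρ,
    ?_, ?_, fun p hp f hf => ?_⟩
  · refine mul_ne_zero hκ0 (ne_of_gt ?_)
    rw [setLIntegral_indicator measurableSet_Iio]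
    rw [setLIntegral_pos_iff (by fun_prop)]
    have : Set.Ioo (0 : ℝ) 1 ⊆
        (Function.support fun ρ : ℝ => ENNReal.ofReal (ρ ^ d)) ∩ (Set.Iio 1 ∩ Set.Ioi 0) := by
      intro x hx
      exact ⟨by simpa using pow_pos hx.1 d, hx.2, hx.1⟩
    exact lt_of_lt_of_le (by simp) (measure_mono this)
  · refine ENNReal.mul_ne_top hκ (ne_of_lt ?_)
    rw [setLIntegral_indicator measurableSet_Iio]
    calc _ ≤ ∫⁻ ρ in Set.Iio (1 : ℝ) ∩ Set.Ioi 0, 1 := by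
          refine setLIntegral_mono' (measurableSet_Iio.inter measurableSet_Ioi) fun x hx => ?_
          rw [ENNReal.ofReal_le_one]
          exact pow_le_one₀ (le_of_lt hx.2) (le_of_lt hx.1)
      _ < ⊤ := by rw [Set.inter_comm, Set.Ioi_inter_Iio]; simp
  obtain ⟨Φ, hΦ⟩ := exists_isometryEquiv_pole d p hp
  let G : ℝ → ℝ → ℝ≥0∞ := fun s r =>
    (Set.Iio 1).indicator (fun u => f (s / u)) √(s ^ 2 + r ^ 2)
  have hG : Measurable (Function.uncurry G) := by
    have : Function.uncurry G = ((fun q : ℝ × ℝ => √(q.1 ^ 2 + q.2 ^ 2)) ⁻¹' Set.Iio 1).indicator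
        (fun q => f (q.1 / √(q.1 ^ 2 + q.2 ^ 2))) := by
      ext q; simp only [Function.uncurry, G, Set.indicator]; rfl
    rw [this]
    exact (by fun_prop : Measurable _).indicator (measurableSet_Iio.preimage (by fun_prop))
  have hG' : ∀ s, Measurable (G s) := fun s => hG.comp measurable_prodMk_left
  have h1 : ∫⁻ x, f (inner ℝ x p) ∂coneMeasure d =
      ∫⁻ s : ℝ, ∫⁻ z : EuclideanSpace ℝ (Fin d), G s ‖z‖ := by
    rw [coneMeasure, lintegral_map (by fun_prop) (by fun_prop),
      ← lintegral_indicator measurableSet_ball,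
      ← (LinearIsometryEquiv.measurePreserving Φ).lintegral_comp_emb
        Φ.toHomeomorph.measurableEmbedding,
      ← (WithLp.volume_preserving_toLp ℝ (EuclideanSpace ℝ (Fin d))).lintegral_comp_emb
        (MeasurableEquiv.toLp 2 _).measurableEmbedding, Measure.volume_eq_prod, lintegral_prod]
    · refine lintegral_congr fun s => lintegral_congr fun z => ?_
      simp only [G, Set.indicator, Metric.mem_ball, dist_zero_right, norm_pole,
        real_inner_smul_left, inner_pole hΦ, Set.mem_Iio]
      simp only [div_eq_inv_mul]
    · refine Measurable.aemeasurable ?_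
      have hf' : Measurable ((Metric.ball 0 1).indicator
          fun x : EuclideanSpace ℝ (Fin (d + 1)) => f (inner ℝ (‖x‖⁻¹ • x) p)) :=
        (by fun_prop : Measurable _).indicator measurableSet_ball
      exact hf'.comp (Φ.continuous.measurable.comp (by fun_prop))
  rw [h1]
  simp_rw [hrad _ (hG' _)]
  rw [lintegral_const_mul, mul_assoc]
  swap
  · exact Measurable.lintegral_prod_right' (ν := volume.restrict (Set.Ioi 0))
      (f := fun q : ℝ × ℝ => ENNReal.ofReal (q.2 ^ (d - 1)) * Function.uncurry G q) (by fun_prop)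
  congr 1
  have h2 : ∫⁻ s : ℝ, ∫⁻ r in Set.Ioi (0 : ℝ), ENNReal.ofReal (r ^ (d - 1)) * G s r =
      ∫⁻ q : ℝ × ℝ, (Set.Ioi 0).indicator (fun r => ENNReal.ofReal (r ^ (d - 1)) * G q.1 r) q.2 := by
    rw [Measure.volume_eq_prod, lintegral_prod]
    · simp_rw [lintegral_indicator measurableSet_Ioi]
    · refine Measurable.aemeasurable ?_
      have : (fun q : ℝ × ℝ =>
          (Set.Ioi 0).indicator (fun r => ENNReal.ofReal (r ^ (d - 1)) * G q.1 r) q.2) =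
          (Prod.snd ⁻¹' Set.Ioi 0).indicator
            (fun q => ENNReal.ofReal (q.2 ^ (d - 1)) * Function.uncurry G q) := by
        ext q; simp only [Set.indicator]; rfl
      rw [this]
      exact (by fun_prop : Measurable _).indicator (measurableSet_Ioi.preimage measurable_snd)
  have h3 : ∫⁻ θ in Set.Ioo 0 Real.pi, ENNReal.ofReal (Real.sin θ ^ (d - 1)) * f (Real.cos θ) =
      ∫⁻ θ in Set.Ioo (-Real.pi) Real.pi, (Set.Ioo 0 Real.pi).indicator
        (fun θ => ENNReal.ofReal (Real.sin θ ^ (d - 1)) * f (Real.cos θ)) θ := by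
    rw [setLIntegral_indicator measurableSet_Ioo, Set.inter_eq_left.2]
    exact Set.Ioo_subset_Ioo_left (by linarith [Real.pi_pos])
  rw [h2, ← lintegral_comp_polarCoord_symm, polarCoord_target, Measure.volume_eq_prod,
    ← Measure.prod_restrict, ← lintegral_cos_eq d hd, h3, ← lintegral_prod_mul]
  · rw [Measure.prod_restrict]
    refine setLIntegral_congr_fun (measurableSet_Ioi.prod measurableSet_Ioo) ?_
    rintro ⟨ρ, θ⟩ ⟨hρ, hθ⟩
    simp only [Set.mem_Ioi] at hρ
    have hsq : √((ρ * Real.cos θ) ^ 2 + (ρ * Real.sin θ) ^ 2) = ρ := by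
      rw [show (ρ * Real.cos θ) ^ 2 + (ρ * Real.sin θ) ^ 2 =
        ρ ^ 2 * (Real.sin θ ^ 2 + Real.cos θ ^ 2) by ring, Real.sin_sq_add_cos_sq, mul_one,
        Real.sqrt_sq hρ.le]
    simp only [polarCoord_symm_apply, G, smul_eq_mul]
    -- Polar coordinates cover the whole plane; only the angles in `(0, π)` meet the half-plane of
    -- positive second coordinate.
    have hiff : 0 < ρ * Real.sin θ ↔ 0 < θ := by
      rw [mul_pos_iff_of_pos_left hρ]
      constructor
      · intro h
        by_contra h'
        exact absurd h (not_lt.2 (Real.sin_nonpos_of_nonpos_of_neg_pi_le (not_lt.1 h') hθ.1.le))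
      · exact fun h => Real.sin_pos_of_pos_of_lt_pi h hθ.2
    by_cases h0 : 0 < θ
    · rw [Set.indicator_of_mem (Set.mem_Ioi.2 (hiff.2 h0)), Set.indicator_of_mem (s := Set.Ioo _ _)
        (show θ ∈ Set.Ioo 0 Real.pi from ⟨h0, hθ.2⟩), hsq]
      by_cases h1 : ρ < 1
      · rw [Set.indicator_of_mem (Set.mem_Iio.2 h1), Set.indicator_of_mem (Set.mem_Iio.2 h1),
          mul_div_cancel_left₀ _ hρ.ne', mul_pow, ENNReal.ofReal_mul (by positivity),
          show ρ ^ d = ρ * ρ ^ (d - 1) by rw [← pow_succ']; congr 1; omega,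
          ENNReal.ofReal_mul (p := ρ) hρ.le]
        ring
      · rw [Set.indicator_of_notMem (by simpa using h1), Set.indicator_of_notMem (by simpa using h1)]
        simp
    · rw [Set.indicator_of_notMem (by rw [Set.mem_Ioi, hiff]; exact h0),
        Set.indicator_of_notMem (s := Set.Ioo _ _) (fun h => h0 h.1)]
      simp
  · exact ((by fun_prop : Measurable _).indicator measurableSet_Iio).aemeasurable
  · exact ((by fun_prop : Measurable _).indicator measurableSet_Ioo).aemeasurable

/-! ### The height distribution and the uniform measure -/

theorem half_sub_one_nonneg {d : ℕ} (hd : 2 ≤ d) : 0 ≤ (d : ℝ) / 2 - 1 := by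
  have : (2 : ℝ) ≤ d := by exact_mod_cast hd
  linarith

theorem capWeight_pos {d : ℕ} {t : ℝ} (ht : t ∈ Set.Ioo (-1 : ℝ) 1) : 0 < capWeight d t :=
  Real.rpow_pos_of_pos (by nlinarith [ht.1, ht.2]) _

theorem continuous_capWeight {d : ℕ} (hd : 2 ≤ d) : Continuous (capWeight d) :=
  Continuous.rpow_const (by fun_prop) fun _ => Or.inr (half_sub_one_nonneg hd)

theorem integrableOn_capWeight {d : ℕ} (hd : 2 ≤ d) :
    IntegrableOn (capWeight d) (Set.Ioo (-1) 1) :=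
  ((continuous_capWeight hd).integrableOn_Icc).mono_set Set.Ioo_subset_Icc_self

theorem two_div_le_integral_capWeight {d : ℕ} (hd : 2 ≤ d) :
    2 / (d : ℝ) ≤ ∫ t in Set.Ioo (-1 : ℝ) 1, capWeight d t := by
  have hm := half_sub_one_nonneg hd
  have hd' : (0 : ℝ) < d := by positivity
  have hc : Continuous fun t : ℝ => (1 - t) ^ ((d : ℝ) / 2 - 1) :=
    Continuous.rpow_const (by fun_prop) fun _ => Or.inr hm
  calc 2 / (d : ℝ) = ∫ t in (0 : ℝ)..1, (1 - t) ^ ((d : ℝ) / 2 - 1) := by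
        rw [intervalIntegral.integral_comp_sub_left (fun t => t ^ ((d : ℝ) / 2 - 1)),
          integral_rpow (Or.inl (by linarith))]
        simp only [sub_self, sub_zero, sub_add_cancel, Real.one_rpow]
        rw [Real.zero_rpow (by positivity)]
        field_simp; norm_num
    _ = ∫ t in Set.Ioo (0 : ℝ) 1, (1 - t) ^ ((d : ℝ) / 2 - 1) := by
        rw [intervalIntegral.integral_of_le zero_le_one, integral_Ioc_eq_integral_Ioo]
    _ ≤ ∫ t in Set.Ioo (0 : ℝ) 1, capWeight d t := by
        refine setIntegral_mono_on (hc.integrableOn_Icc.mono_set Set.Ioo_subset_Icc_self)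
          ((integrableOn_capWeight hd).mono_set (Set.Ioo_subset_Ioo_left (by norm_num)))
          measurableSet_Ioo fun t ht => ?_
        exact Real.rpow_le_rpow (by linarith [ht.2]) (by nlinarith [ht.1, ht.2]) hm
    _ ≤ _ := by
        refine setIntegral_mono_set (integrableOn_capWeight hd) ?_
          (Set.Ioo_subset_Ioo_left (by norm_num)).eventuallyLE
        filter_upwards [ae_restrict_mem measurableSet_Ioo] with t ht
        exact (capWeight_pos ht).le

/-- The normalising constant of the weight `(1 - t²)^(d/2 - 1)` on `(-1, 1)`. -/
noncomputable def capConst (d : ℕ) : ℝ := (∫ t in Set.Ioo (-1 : ℝ) 1, capWeight d t)⁻¹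

theorem integral_capWeight_pos {d : ℕ} (hd : 2 ≤ d) :
    0 < ∫ t in Set.Ioo (-1 : ℝ) 1, capWeight d t :=
  lt_of_lt_of_le (by positivity) (two_div_le_integral_capWeight hd)

theorem capConst_pos {d : ℕ} (hd : 2 ≤ d) : 0 < capConst d := inv_pos.2 (integral_capWeight_pos hd)

theorem capConst_le {d : ℕ} (hd : 2 ≤ d) : capConst d ≤ d / 2 := by
  rw [capConst, ← inv_div 2 (d : ℝ)]
  exact inv_anti₀ (by positivity) (two_div_le_integral_capWeight hd)

theorem capConst_two : capConst 2 = 1 / 2 := by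
  simp only [capConst, capWeight]
  norm_num

/-- The distribution of the height of a uniformly distributed point of the sphere. -/
noncomputable def heightMeasure (d : ℕ) : Measure ℝ :=
  (volume.restrict (Set.Ioo (-1) 1)).withDensity fun t => ENNReal.ofReal (capConst d * capWeight d t)

theorem measurable_height_density {d : ℕ} (hd : 2 ≤ d) :
    Measurable fun t => ENNReal.ofReal (capConst d * capWeight d t) :=
  ENNReal.measurable_ofReal.comp ((continuous_capWeight hd).measurable.const_mul _)

theorem lintegral_heightMeasure {d : ℕ} (hd : 2 ≤ d) {f : ℝ → ℝ≥0∞} (hf : Measurable f) :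
    ∫⁻ t, f t ∂heightMeasure d =
      ∫⁻ t in Set.Ioo (-1) 1, ENNReal.ofReal (capConst d * capWeight d t) * f t := by
  rw [heightMeasure, lintegral_withDensity_eq_lintegral_mul _ (measurable_height_density hd) hf]
  rfl

theorem integral_heightMeasure {d : ℕ} (hd : 2 ≤ d) (f : ℝ → ℝ) :
    ∫ t, f t ∂heightMeasure d =
      ∫ t in Set.Ioo (-1) 1, capConst d * capWeight d t * f t := by
  rw [heightMeasure, integral_withDensity_eq_integral_toReal_smul (measurable_height_density hd)
    (by simp)]
  refine setIntegral_congr_fun measurableSet_Ioo fun t ht => ?_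
  simp only [smul_eq_mul]
  rw [ENNReal.toReal_ofReal (mul_pos (capConst_pos hd) (capWeight_pos ht)).le]

theorem isProbabilityMeasure_heightMeasure {d : ℕ} (hd : 2 ≤ d) :
    IsProbabilityMeasure (heightMeasure d) := by
  refine ⟨?_⟩
  rw [← lintegral_one, lintegral_heightMeasure hd measurable_const]
  simp only [mul_one]
  rw [← ofReal_integral_eq_lintegral_ofReal ((integrableOn_capWeight hd).const_mul _),
    integral_const_mul, capConst, inv_mul_cancel₀ (integral_capWeight_pos hd).ne', ENNReal.ofReal_one]
  filter_upwards [ae_restrict_mem measurableSet_Ioo] with t ht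
  exact (mul_pos (capConst_pos hd) (capWeight_pos ht)).le

/-- The uniform probability measure on the unit sphere of `ℝ^(d+1)`. -/
noncomputable def sphereMeasure (d : ℕ) : Measure (EuclideanSpace ℝ (Fin (d + 1))) :=
  (coneMeasure d Set.univ)⁻¹ • coneMeasure d

theorem map_inner_sphereMeasure {d : ℕ} (hd : 2 ≤ d) {p : EuclideanSpace ℝ (Fin (d + 1))}
    (hp : ‖p‖ = 1) : (sphereMeasure d).map (fun x => inner ℝ x p) = heightMeasure d := by
  obtain ⟨C, hC0, hC, h⟩ := exists_lintegral_coneMeasure d hd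
  have hI := integral_capWeight_pos hd
  have huniv : coneMeasure d Set.univ =
      C * ENNReal.ofReal (∫ t in Set.Ioo (-1 : ℝ) 1, capWeight d t) := by
    rw [← lintegral_one, h p hp (fun _ => 1) measurable_const]
    simp only [one_mul]
    rw [ofReal_integral_eq_lintegral_ofReal (integrableOn_capWeight hd)]
    filter_upwards [ae_restrict_mem measurableSet_Ioo] with t ht
    exact (capWeight_pos ht).le
  refine Measure.ext_of_lintegral _ fun f hf => ?_
  rw [lintegral_map hf (by fun_prop), lintegral_heightMeasure hd hf, sphereMeasure,
    lintegral_smul_measure, h p hp f hf, huniv, smul_eq_mul, ← mul_assoc,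
    ENNReal.mul_inv (Or.inl hC0) (Or.inl hC), mul_right_comm C⁻¹ _ C, ENNReal.inv_mul_cancel hC0 hC, one_mul,
    ← ENNReal.ofReal_inv_of_pos hI, ← capConst, ← lintegral_const_mul]
  · refine lintegral_congr fun t => ?_
    rw [ENNReal.ofReal_mul (capConst_pos hd).le]
    ring
  · exact hf.mul (continuous_capWeight hd).measurable.ennreal_ofReal

theorem exists_norm_eq_one (d : ℕ) : ∃ p : EuclideanSpace ℝ (Fin (d + 1)), ‖p‖ = 1 :=
  ⟨EuclideanSpace.single 0 1, by simp⟩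

theorem isProbabilityMeasure_sphereMeasure {d : ℕ} (hd : 2 ≤ d) :
    IsProbabilityMeasure (sphereMeasure d) := by
  obtain ⟨p, hp⟩ := exists_norm_eq_one d
  refine ⟨?_⟩
  have := isProbabilityMeasure_heightMeasure hd
  rw [← measure_univ (μ := heightMeasure d), ← map_inner_sphereMeasure hd hp,
    Measure.map_apply (by fun_prop) MeasurableSet.univ, Set.preimage_univ]

theorem sphereMeasure_compl_unitSphere (d : ℕ) : sphereMeasure d (unitSphere d)ᶜ = 0 := by
  rw [sphereMeasure, Measure.smul_apply, coneMeasure, Measure.map_apply (by fun_prop)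
    (show MeasurableSet (unitSphere d)ᶜ from Metric.isClosed_sphere.measurableSet.compl)]
  -- Since `0⁻¹ = 0`, the radial projection sends the origin to itself; it is the only point not
  -- sent to the sphere.
  refine mul_eq_zero_of_right _ (measure_mono_null (t := {0}) ?_ ?_)
  · intro x hx
    by_contra h
    simp only [Set.mem_singleton_iff] at h
    exact hx (by simp [unitSphere, norm_smul, h])
  · exact Measure.absolutelyContinuous_of_le Measure.restrict_le_self (by simp)

theorem integral_inner_sphereMeasure {d : ℕ} (hd : 2 ≤ d) {p : EuclideanSpace ℝ (Fin (d + 1))}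
    (hp : ‖p‖ = 1) {f : ℝ → ℝ} (hf : Measurable f) :
    ∫ x, f (inner ℝ x p) ∂sphereMeasure d = ∫ t, f t ∂heightMeasure d := by
  rw [← map_inner_sphereMeasure hd hp, integral_map (by fun_prop) hf.aestronglyMeasurable]

theorem lintegral_inner_sphereMeasure {d : ℕ} (hd : 2 ≤ d) {p : EuclideanSpace ℝ (Fin (d + 1))}
    (hp : ‖p‖ = 1) {f : ℝ → ℝ≥0∞} (hf : Measurable f) :
    ∫⁻ x, f (inner ℝ x p) ∂sphereMeasure d = ∫⁻ t, f t ∂heightMeasure d := by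
  rw [← map_inner_sphereMeasure hd hp, lintegral_map hf (by fun_prop)]

theorem sphereMeasure_cap {d : ℕ} (hd : 2 ≤ d) {p : EuclideanSpace ℝ (Fin (d + 1))}
    (hp : ‖p‖ = 1) {a : ℝ} (ha : -1 ≤ a) :
    sphereMeasure d {x | a < inner ℝ x p} =
      ∫⁻ t in Set.Ioo a 1, ENNReal.ofReal (capConst d * capWeight d t) := by
  have : {x : EuclideanSpace ℝ (Fin (d + 1)) | a < inner ℝ x p} =
    (fun x => inner ℝ x p) ⁻¹' Set.Ioi a := rfl
  rw [this, ← Measure.map_apply (by fun_prop) measurableSet_Ioi, map_inner_sphereMeasure hd hp,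
    heightMeasure, withDensity_apply _ measurableSet_Ioi, Measure.restrict_restrict measurableSet_Ioi]
  congr 2
  ext t
  simp only [Set.mem_inter_iff, Set.mem_Ioi, Set.mem_Ioo]
  exact ⟨fun h => ⟨h.1, h.2.2⟩, fun h => ⟨h.1, by linarith, h.2⟩⟩

/-! ### Hausdorff measure of small caps and the value of `F_d` -/

theorem LipschitzOnWith.euclideanHausdorffMeasure_image_le {X Y : Type*} [EMetricSpace X]
    [MeasurableSpace X] [BorelSpace X] [EMetricSpace Y] [MeasurableSpace Y] [BorelSpace Y]
    {K : NNReal} {f : X → Y} {s : Set X} (h : LipschitzOnWith K f s) (d : ℕ) :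
    μHE[d] (f '' s) ≤ (K : ℝ≥0∞) ^ d * μHE[d] s := by
  simp only [Measure.euclideanHausdorffMeasure_def, Measure.smul_apply]
  have := h.hausdorffMeasure_image_le (d := d) (by positivity)
  rw [mul_smul_comm]
  rw [ENNReal.rpow_natCast] at this
  gcongr

/-- The open spherical cap around `p` of points of height larger than `a`. -/
def sphericalCap {d : ℕ} (p : EuclideanSpace ℝ (Fin (d + 1))) (a : ℝ) :
    Set (EuclideanSpace ℝ (Fin (d + 1))) := unitSphere d ∩ {x | a < inner ℝ x p}

theorem pole_decomp {d : ℕ} {p : EuclideanSpace ℝ (Fin (d + 1))}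
    {Φ : WithLp 2 (ℝ × EuclideanSpace ℝ (Fin d)) ≃ₗᵢ[ℝ] EuclideanSpace ℝ (Fin (d + 1))}
    (hΦ : Φ (WithLp.toLp 2 (1, 0)) = p) (x : EuclideanSpace ℝ (Fin (d + 1))) :
    x = Φ (WithLp.toLp 2 (inner ℝ x p, (Φ.symm x).snd)) := by
  have h1 : WithLp.toLp 2 ((Φ.symm x).fst, (Φ.symm x).snd) = Φ.symm x := rfl
  have h2 : inner ℝ x p = (Φ.symm x).fst := by
    rw [← inner_pole hΦ (Φ.symm x).fst (Φ.symm x).snd, h1, LinearIsometryEquiv.apply_symm_apply]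
  rw [h2, h1, LinearIsometryEquiv.apply_symm_apply]

theorem mem_unitSphere_pole {d : ℕ}
    (Φ : WithLp 2 (ℝ × EuclideanSpace ℝ (Fin d)) ≃ₗᵢ[ℝ] EuclideanSpace ℝ (Fin (d + 1)))
    (s : ℝ) (z : EuclideanSpace ℝ (Fin d)) :
    Φ (WithLp.toLp 2 (s, z)) ∈ unitSphere d ↔ s ^ 2 + ‖z‖ ^ 2 = 1 := by
  rw [unitSphere, mem_sphere_zero_iff_norm, norm_pole, Real.sqrt_eq_one]

/-- Orthogonal projection along `p` is 1-Lipschitz and maps the cap onto a set containing the ball.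
-/
theorem volume_ball_le_sphericalCap {d : ℕ} {p : EuclideanSpace ℝ (Fin (d + 1))} (hp : ‖p‖ = 1)
    {a : ℝ} :
    volume (Metric.ball (0 : EuclideanSpace ℝ (Fin d)) √(1 - a ^ 2)) ≤
      μHE[d] (sphericalCap p a) := by
  obtain ⟨Φ, hΦ⟩ := exists_isometryEquiv_pole d p hp
  have hL : LipschitzWith 1 fun x => (Φ.symm x).snd := by
    refine LipschitzWith.of_dist_le_mul fun x y => ?_
    rw [NNReal.coe_one, one_mul, ← Φ.symm.dist_map, dist_eq_norm, dist_eq_norm,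
      WithLp.prod_norm_eq_of_L2 (Φ.symm x - Φ.symm y)]
    refine Real.le_sqrt_of_sq_le ?_
    simpa using sq_nonneg _
  have himg : Metric.ball (0 : EuclideanSpace ℝ (Fin d)) √(1 - a ^ 2) ⊆
      (fun x => (Φ.symm x).snd) '' sphericalCap p a := by
    intro z hz
    have hz2 : ‖z‖ ^ 2 < 1 - a ^ 2 := by
      rw [mem_ball_zero_iff, Real.lt_sqrt (norm_nonneg _)] at hz
      exact hz
    refine ⟨Φ (WithLp.toLp 2 (√(1 - ‖z‖ ^ 2), z)), ⟨?_, ?_⟩, by simp⟩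
    · rw [mem_unitSphere_pole, Real.sq_sqrt (by nlinarith)]
      ring
    · rw [Set.mem_ofPred_eq, inner_pole hΦ]
      exact Real.lt_sqrt_of_sq_lt (by linarith)
  have := (hL.lipschitzOnWith (s := sphericalCap p a)).euclideanHausdorffMeasure_image_le d
  rw [ENNReal.coe_one, one_pow, one_mul] at this
  rw [← EuclideanSpace.euclideanHausdorffMeasure_eq_volume]
  exact (measure_mono himg).trans this

/-- The cap is the graph of `√(1 - ‖z‖²)` over the ball. Above height `a` its slope is at most `√(1
- a²) / a`, so the graph map has Lipschitz constant `1 / a`. -/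
theorem sphericalCap_le_volume_ball {d : ℕ} {p : EuclideanSpace ℝ (Fin (d + 1))} (hp : ‖p‖ = 1)
    {a : ℝ} (ha : 0 < a) :
    μHE[d] (sphericalCap p a) ≤ ENNReal.ofReal (1 / a) ^ d *
      volume (Metric.ball (0 : EuclideanSpace ℝ (Fin d)) √(1 - a ^ 2)) := by
  obtain ⟨Φ, hΦ⟩ := exists_isometryEquiv_pole d p hp
  set B := Metric.ball (0 : EuclideanSpace ℝ (Fin d)) √(1 - a ^ 2)
  have hB : ∀ z ∈ B, ‖z‖ ^ 2 < 1 - a ^ 2 := fun z hz => by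
    rwa [mem_ball_zero_iff, Real.lt_sqrt (norm_nonneg _)] at hz
  have hL : LipschitzOnWith (1 / a).toNNReal
      (fun z => Φ (WithLp.toLp 2 (√(1 - ‖z‖ ^ 2), z))) B := by
    refine LipschitzOnWith.of_dist_le_mul fun z hz w hw => ?_
    have hz2 := hB z hz
    have hw2 := hB w hw
    rw [Real.coe_toNNReal _ (by positivity), Φ.dist_map, dist_eq_norm, dist_eq_norm,
      WithLp.prod_norm_eq_of_L2]
    refine Real.sqrt_le_iff.2 ⟨by positivity, ?_⟩
    simp only [WithLp.sub_fst, WithLp.sub_snd, Real.norm_eq_abs, sq_abs]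
    set h := √(1 - ‖z‖ ^ 2)
    set k := √(1 - ‖w‖ ^ 2)
    have hh : h ^ 2 = 1 - ‖z‖ ^ 2 := Real.sq_sqrt (by nlinarith)
    have hk : k ^ 2 = 1 - ‖w‖ ^ 2 := Real.sq_sqrt (by nlinarith)
    have hha : a < h := Real.lt_sqrt_of_sq_lt (by linarith)
    have hka : a < k := Real.lt_sqrt_of_sq_lt (by linarith)
    have h1 : (h - k) ^ 2 * (h + k) ^ 2 = (‖z‖ - ‖w‖) ^ 2 * (‖z‖ + ‖w‖) ^ 2 := by
      rw [← mul_pow, ← mul_pow, show (h - k) * (h + k) = -((‖z‖ - ‖w‖) * (‖z‖ + ‖w‖)) by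
        linear_combination hh - hk]
      ring
    have h2 : (‖z‖ - ‖w‖) ^ 2 ≤ ‖z - w‖ ^ 2 := by
      rw [sq_le_sq, abs_norm]; exact abs_norm_sub_norm_le z w
    have h3 : (‖z‖ + ‖w‖) ^ 2 ≤ 4 * (1 - a ^ 2) := by
      nlinarith [sq_nonneg (‖z‖ - ‖w‖)]
    have h4 : 4 * a ^ 2 ≤ (h + k) ^ 2 := by nlinarith
    have h5 : (h - k) ^ 2 * (4 * a ^ 2) ≤ ‖z - w‖ ^ 2 * (4 * (1 - a ^ 2)) :=
      calc _ ≤ (h - k) ^ 2 * (h + k) ^ 2 := by gcongr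
        _ = _ := h1
        _ ≤ _ := by gcongr
    change (h - k) ^ 2 + ‖z - w‖ ^ 2 ≤ _
    rw [mul_pow, div_pow, one_pow, one_div_mul_eq_div, le_div_iff₀ (by positivity)]
    nlinarith
  have hsub : sphericalCap p a ⊆ (fun z => Φ (WithLp.toLp 2 (√(1 - ‖z‖ ^ 2), z))) '' B := by
    rintro x ⟨hx, hxa⟩
    rw [Set.mem_ofPred_eq] at hxa
    have hdec := pole_decomp hΦ x
    set s := inner ℝ x p
    set z := (Φ.symm x).snd
    rw [hdec, mem_unitSphere_pole] at hx
    refine ⟨z, ?_, ?_⟩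
    · rw [mem_ball_zero_iff, Real.lt_sqrt (norm_nonneg _)]
      nlinarith
    · simp only
      rw [show 1 - ‖z‖ ^ 2 = s ^ 2 by linarith, Real.sqrt_sq (by linarith)]
      exact hdec.symm
  rw [← EuclideanSpace.euclideanHausdorffMeasure_eq_volume]
  exact (measure_mono hsub).trans (hL.euclideanHausdorffMeasure_image_le d)

theorem measurableSet_unitSphere (d : ℕ) : MeasurableSet (unitSphere d) :=
  Metric.isClosed_sphere.measurableSet

theorem isCompact_unitSphere (d : ℕ) : IsCompact (unitSphere d) := isCompact_sphere 0 1

theorem norm_of_mem_unitSphere {d : ℕ} {x : EuclideanSpace ℝ (Fin (d + 1))}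
    (hx : x ∈ unitSphere d) : ‖x‖ = 1 := mem_sphere_zero_iff_norm.1 hx

theorem euclideanHausdorffMeasure_unitSphere_lt_top (d : ℕ) : μHE[d] (unitSphere d) < ⊤ := by
  refine (isCompact_unitSphere d).measure_lt_top_of_nhdsWithin fun x hx => ?_
  have hx1 := norm_of_mem_unitSphere hx
  refine ⟨sphericalCap x (1 / 2), ?_, ?_⟩
  · refine inter_mem self_mem_nhdsWithin (mem_nhdsWithin_of_mem_nhds (IsOpen.mem_nhds ?_ ?_))
    · exact isOpen_lt continuous_const (by fun_prop)
    · rw [Set.mem_ofPred_eq, real_inner_self_eq_norm_sq, hx1]; norm_num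
  · refine (sphericalCap_le_volume_ball hx1 (by norm_num)).trans_lt ?_
    exact ENNReal.mul_lt_top (by finiteness) measure_ball_lt_top

/-- Fubini on the pairs `(x, p)` with `a < ⟪x, p⟫`. This links the Hausdorff and uniform measures
without identifying them on the sphere. -/
theorem lintegral_sphericalCap {d : ℕ} (hd : 2 ≤ d) (a : ℝ) {V : ℝ≥0∞}
    (hV : ∀ p : EuclideanSpace ℝ (Fin (d + 1)), ‖p‖ = 1 →
      sphereMeasure d {x | a < inner ℝ x p} = V) :
    V * μHE[d] (unitSphere d) = ∫⁻ p, μHE[d] (sphericalCap p a) ∂sphereMeasure d := by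
  have := isProbabilityMeasure_sphereMeasure hd
  -- The restriction to the sphere is finite, as required for exchanging the integrals.
  have hfin : IsFiniteMeasure
      ((μHE[d] : Measure (EuclideanSpace ℝ (Fin (d + 1)))).restrict (unitSphere d)) :=
    ⟨by simpa using euclideanHausdorffMeasure_unitSphere_lt_top d⟩
  set H := (μHE[d] : Measure (EuclideanSpace ℝ (Fin (d + 1)))).restrict (unitSphere d)
  have hA : MeasurableSet {q : EuclideanSpace ℝ (Fin (d + 1)) × EuclideanSpace ℝ (Fin (d + 1)) |
      a < inner ℝ q.1 q.2} := measurableSet_lt measurable_const (by fun_prop)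
  have h1 := Measure.prod_apply (μ := H) (ν := sphereMeasure d) hA
  have h2 := Measure.prod_apply_symm (μ := H) (ν := sphereMeasure d) hA
  rw [h1] at h2
  have h3 : ∫⁻ x, sphereMeasure d (Prod.mk x ⁻¹' {q | a < inner ℝ q.1 q.2}) ∂H =
      V * μHE[d] (unitSphere d) := by
    rw [setLIntegral_congr_fun (g := fun _ => V) (measurableSet_unitSphere d), lintegral_const,
      Measure.restrict_apply_univ]
    intro x hx
    simp only
    rw [← hV x (norm_of_mem_unitSphere hx)]
    congr 1
    ext y
    simp [real_inner_comm]
  rw [← h3, h2]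
  refine lintegral_congr fun p => ?_
  rw [Measure.restrict_apply (hA.preimage measurable_prodMk_right), sphericalCap, Set.inter_comm]
  rfl

/-- The extra factor `t` makes the integrand an exact derivative. On `(a, 1)` this factor lies
between `a` and `1`, so the cap integral itself is known up to a factor `a`. -/
theorem integral_id_mul_capWeight {d : ℕ} (hd : 2 ≤ d) {a : ℝ} (ha : 0 < a) (ha' : a < 1) :
    ∫ t in Set.Ioo a 1, t * capWeight d t = √(1 - a ^ 2) ^ d / d := by
  have hm := half_sub_one_nonneg hd
  have hd0 : (d : ℝ) ≠ 0 := by positivity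
  rw [← integral_Ioc_eq_integral_Ioo, ← intervalIntegral.integral_of_le ha'.le,
    intervalIntegral.integral_eq_sub_of_hasDerivAt
      (f := fun t => -((1 - t ^ 2) ^ ((d : ℝ) / 2)) / d)]
  · have : √(1 - a ^ 2) ^ d = (1 - a ^ 2) ^ ((d : ℝ) / 2) := by
      rw [Real.sqrt_eq_rpow, ← Real.rpow_natCast, ← Real.rpow_mul (by nlinarith)]
      congr 1; ring
    rw [this]
    norm_num
    rw [Real.zero_rpow (by positivity)]
    ring
  · intro t _
    have h1 : HasDerivAt (fun t : ℝ => 1 - t ^ 2) (-(2 * t)) t := by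
      simpa using (hasDerivAt_pow 2 t).const_sub 1
    have h2 := ((h1.rpow_const (p := (d : ℝ) / 2) (Or.inr (by linarith))).neg).div_const (d : ℝ)
    refine HasDerivAt.congr_deriv (f := fun t : ℝ => -((1 - t ^ 2) ^ ((d : ℝ) / 2)) / (d : ℝ)) h2 ?_
    simp only [capWeight]
    field_simp
  · exact (Continuous.mul continuous_id (continuous_capWeight hd)).intervalIntegrable _ _

theorem sphereMeasure_cap_eq {d : ℕ} (hd : 2 ≤ d) {p : EuclideanSpace ℝ (Fin (d + 1))}
    (hp : ‖p‖ = 1) {a : ℝ} (ha : -1 ≤ a) :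
    sphereMeasure d {x | a < inner ℝ x p} =
      ENNReal.ofReal (capConst d * ∫ t in Set.Ioo a 1, capWeight d t) := by
  have hsub : Set.Ioo a 1 ⊆ Set.Ioo (-1) 1 := Set.Ioo_subset_Ioo_left ha
  rw [sphereMeasure_cap hd hp ha, ← integral_const_mul, ofReal_integral_eq_lintegral_ofReal]
  · exact ((integrableOn_capWeight hd).mono_set hsub).const_mul _
  · filter_upwards [ae_restrict_mem measurableSet_Ioo] with t ht
    exact (mul_pos (capConst_pos hd) (capWeight_pos (hsub ht))).le

theorem integral_capWeight_bounds {d : ℕ} (hd : 2 ≤ d) {a : ℝ} (ha : 0 < a) (ha' : a < 1) :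
    √(1 - a ^ 2) ^ d / d ≤ ∫ t in Set.Ioo a 1, capWeight d t ∧
      a * ∫ t in Set.Ioo a 1, capWeight d t ≤ √(1 - a ^ 2) ^ d / d := by
  have hsub : Set.Ioo a 1 ⊆ Set.Ioo (-1) 1 := Set.Ioo_subset_Ioo_left (by linarith)
  have hi := (integrableOn_capWeight hd).mono_set hsub
  have hi' : IntegrableOn (fun t => t * capWeight d t) (Set.Ioo a 1) :=
    ((Continuous.mul continuous_id (continuous_capWeight hd)).integrableOn_Icc).mono_set
      Set.Ioo_subset_Icc_self
  rw [← integral_id_mul_capWeight hd ha ha', ← integral_const_mul]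
  constructor
  · refine setIntegral_mono_on hi' hi measurableSet_Ioo fun t ht => ?_
    have := capWeight_pos (d := d) (hsub ht)
    nlinarith [ht.2]
  · refine setIntegral_mono_on (hi.const_mul a) hi' measurableSet_Ioo fun t ht => ?_
    have := capWeight_pos (d := d) (hsub ht)
    nlinarith [ht.1]

/-- Both the uniform measure of a cap, times the area of the sphere, and the average Hausdorff
measure of caps are comparable to `√(1 - a²)^d`. After that factor cancels, the inequalities become
equalities as `a → 1`. -/
theorem ballSphereRatio_bounds {d : ℕ} (hd : 2 ≤ d) {a : ℝ} (ha : 0 < a) (ha' : a < 1) :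
    a ^ d * (capConst d / d) ≤ ballSphereRatio d ∧ a * ballSphereRatio d ≤ capConst d / d := by
  have := isProbabilityMeasure_sphereMeasure hd
  have : Nonempty (Fin d) := ⟨⟨0, by omega⟩⟩
  have hd0 : (0 : ℝ) < d := by positivity
  have hc := capConst_pos hd
  set I := ∫ t in Set.Ioo a 1, capWeight d t
  obtain ⟨hI1, hI2⟩ := integral_capWeight_bounds hd ha ha'
  set ρ := √(1 - a ^ 2)
  have hρ : 0 < ρ := Real.sqrt_pos.2 (by nlinarith)
  have hI0 : 0 < I := lt_of_lt_of_le (by positivity) hI1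
  have hfub := lintegral_sphericalCap hd a (V := ENNReal.ofReal (capConst d * I))
    fun p hp => sphereMeasure_cap_eq hd hp (by linarith)
  have hfin := euclideanHausdorffMeasure_unitSphere_lt_top d
  set S := μHE[d] (unitSphere d)
  set B := volume (Metric.ball (0 : EuclideanSpace ℝ (Fin d)) ρ)
  have hae : ∀ᵐ p ∂sphereMeasure d, ‖p‖ = 1 := by
    have : ∀ᵐ p ∂sphereMeasure d, p ∈ unitSphere d := sphereMeasure_compl_unitSphere d
    filter_upwards [this] with p hp using norm_of_mem_unitSphere hp
  have hlow : B ≤ ENNReal.ofReal (capConst d * I) * S := by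
    rw [hfub]
    calc B = ∫⁻ _, B ∂sphereMeasure d := by simp
      _ ≤ _ := lintegral_mono_ae (by
        filter_upwards [hae] with p hp using volume_ball_le_sphericalCap hp)
  have hupp : ENNReal.ofReal (capConst d * I) * S ≤ ENNReal.ofReal (1 / a) ^ d * B := by
    rw [hfub]
    calc _ ≤ ∫⁻ _, ENNReal.ofReal (1 / a) ^ d * B ∂sphereMeasure d := lintegral_mono_ae (by
          filter_upwards [hae] with p hp using sphericalCap_le_volume_ball hp ha)
      _ = _ := by simp
  set κ := (volume (Metric.ball (0 : EuclideanSpace ℝ (Fin d)) 1)).toReal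
  have hκ : 0 < κ := ENNReal.toReal_pos (Metric.measure_ball_pos _ _ one_pos).ne'
    measure_ball_lt_top.ne
  have hB : B.toReal = ρ ^ d * κ := by
    simp only [B, κ]
    rw [Measure.addHaar_ball _ _ hρ.le, ENNReal.toReal_mul, ENNReal.toReal_ofReal (by positivity)]
    simp
  have hBtop : B ≠ ⊤ := measure_ball_lt_top.ne
  have h1 : ρ ^ d * κ ≤ capConst d * I * S.toReal := by
    have := ENNReal.toReal_mono (ENNReal.mul_ne_top ENNReal.ofReal_ne_top hfin.ne) hlow
    rwa [hB, ENNReal.toReal_mul, ENNReal.toReal_ofReal (by positivity)] at this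
  have h2 : capConst d * I * S.toReal ≤ (1 / a) ^ d * (ρ ^ d * κ) := by
    have := ENNReal.toReal_mono (ENNReal.mul_ne_top (by finiteness) hBtop) hupp
    rwa [ENNReal.toReal_mul, ENNReal.toReal_mul, ENNReal.toReal_pow, hB,
      ENNReal.toReal_ofReal (by positivity), ENNReal.toReal_ofReal (by positivity)] at this
  have hS : 0 < S.toReal := by
    have : 0 < capConst d * I * S.toReal := lt_of_lt_of_le (by positivity) h1
    exact pos_of_mul_pos_right this (by positivity)
  have hF : ballSphereRatio d = κ / S.toReal := by
    rw [ballSphereRatio, unitBall, EuclideanSpace.euclideanHausdorffMeasure_eq_volume,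
      Measure.addHaar_closedBall_eq_addHaar_ball]
  rw [hF]
  have hρd : 0 < ρ ^ d := by positivity
  constructor
  · rw [le_div_iff₀ hS]
    have h3 : a ^ d * (capConst d * I * S.toReal) ≤ ρ ^ d * κ := by
      calc _ ≤ a ^ d * ((1 / a) ^ d * (ρ ^ d * κ)) := by gcongr
        _ = _ := by rw [← mul_assoc, ← mul_pow, mul_one_div_cancel ha.ne', one_pow, one_mul]
    have h4 : a ^ d * (capConst d * (ρ ^ d / d) * S.toReal) ≤ ρ ^ d * κ := le_trans (by gcongr) h3
    refine le_of_mul_le_mul_left (le_of_eq_of_le ?_ h4) hρd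
    ring
  · rw [← mul_div_assoc, div_le_iff₀ hS]
    have h3 : a * (ρ ^ d * κ) ≤ capConst d * (ρ ^ d / d) * S.toReal := by
      calc _ ≤ a * (capConst d * I * S.toReal) := by gcongr
        _ = capConst d * (a * I) * S.toReal := by ring
        _ ≤ _ := by gcongr
    refine le_of_mul_le_mul_left (le_trans (le_of_eq ?_) (h3.trans (le_of_eq ?_))) hρd <;> ring

theorem ballSphereRatio_eq {d : ℕ} (hd : 2 ≤ d) : ballSphereRatio d = capConst d / d := by
  have hev : ∀ᶠ a : ℝ in nhdsWithin 1 (Set.Iio 1), a ∈ Set.Ioo (0 : ℝ) 1 :=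
    Ioo_mem_nhdsLT one_pos
  have hlim : Tendsto (fun a : ℝ => a ^ d * (capConst d / d)) (nhdsWithin 1 (Set.Iio 1))
      (nhds (capConst d / d)) := by
    have : Continuous fun a : ℝ => a ^ d * (capConst d / d) := by fun_prop
    simpa using (this.tendsto 1).mono_left nhdsWithin_le_nhds
  have hlim' : Tendsto (fun a : ℝ => a * ballSphereRatio d) (nhdsWithin 1 (Set.Iio 1))
      (nhds (ballSphereRatio d)) := by
    have : Continuous fun a : ℝ => a * ballSphereRatio d := by fun_prop
    simpa using (this.tendsto 1).mono_left nhdsWithin_le_nhds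
  refine le_antisymm (le_of_tendsto hlim' ?_) (le_of_tendsto hlim ?_)
  · filter_upwards [hev] with a ha using (ballSphereRatio_bounds hd ha.1 ha.2).2
  · filter_upwards [hev] with a ha using (ballSphereRatio_bounds hd ha.1 ha.2).1

theorem ballSphereRatio_pos {d : ℕ} (hd : 2 ≤ d) : 0 < ballSphereRatio d := by
  rw [ballSphereRatio_eq hd]
  have := capConst_pos hd
  positivity

/-! ### Digamma values and positivity of `c(d)` -/

theorem realDigamma_one : realDigamma 1 = -Real.eulerMascheroniConstant := by
  rw [realDigamma, Complex.ofReal_one, Complex.digamma_one, ← Complex.ofReal_neg, Complex.ofReal_re]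

theorem realDigamma_add_one {x : ℝ} (hx : 0 < x) : realDigamma (x + 1) = realDigamma x + x⁻¹ := by
  rw [realDigamma, realDigamma, Complex.ofReal_add, Complex.ofReal_one, Complex.digamma_apply_add_one,
    ← Complex.ofReal_inv, Complex.add_re, Complex.ofReal_re]
  intro m h
  have : x = -(m : ℝ) := by exact_mod_cast h
  have h2 : (0 : ℝ) ≤ m := Nat.cast_nonneg m
  linarith

theorem realDigamma_three_halves :
    realDigamma (3 / 2) = 2 - 2 * Real.log 2 - Real.eulerMascheroniConstant := by
  have h : realDigamma (1 / 2) = -2 * Real.log 2 - Real.eulerMascheroniConstant := by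
    have h1 : ((1 / 2 : ℝ) : ℂ) = 1 / 2 := by push_cast; rfl
    have h2 : (-2 * Complex.log 2 - Real.eulerMascheroniConstant : ℂ) =
        ((-2 * Real.log 2 - Real.eulerMascheroniConstant : ℝ) : ℂ) := by
      push_cast [Complex.ofReal_log (zero_le_two (α := ℝ))]; rfl
    rw [realDigamma, h1, Complex.digamma_one_half, h2, Complex.ofReal_re]
  rw [show (3 / 2 : ℝ) = 1 / 2 + 1 by norm_num, realDigamma_add_one (by norm_num), h]
  norm_num
  ring

/-- The difference `ψ(d/2) - ψ(1)`. -/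
noncomputable def digammaGap (d : ℕ) : ℝ := realDigamma ((d : ℝ) / 2) - realDigamma 1

theorem digammaGap_two : digammaGap 2 = 0 := by simp [digammaGap]

theorem digammaGap_three : digammaGap 3 = 2 - 2 * Real.log 2 := by
  rw [digammaGap, Nat.cast_ofNat, realDigamma_three_halves, realDigamma_one]; ring

theorem digammaGap_add_two {d : ℕ} (hd : 0 < d) : digammaGap (d + 2) = digammaGap d + 2 / d := by
  have hd' : (0 : ℝ) < d := by exact_mod_cast hd
  rw [digammaGap, digammaGap, show ((d + 2 : ℕ) : ℝ) / 2 = (d : ℝ) / 2 + 1 by push_cast; ring,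
    realDigamma_add_one (by positivity), inv_div]
  ring

theorem log_two_le_digammaGap (d : ℕ) : Real.log 2 ≤ digammaGap (d + 4) := by
  have hlog := Real.log_two_lt_d9
  induction d using Nat.twoStepInduction with
  | zero => rw [digammaGap_add_two (d := 2) (by norm_num), digammaGap_two]; norm_num; linarith
  | one => rw [digammaGap_add_two (d := 3) (by norm_num), digammaGap_three]; norm_num; linarith
  | more d h _ =>
    rw [show d + 2 + 4 = d + 4 + 2 by ring, digammaGap_add_two (by omega)]
    have : (0 : ℝ) ≤ 2 / ((d + 4 : ℕ) : ℝ) := by positivity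
    linarith

/-- Since `F_d ≤ 1/2`, the term `1 - log F_d` is at least `1 + log 2`. For `d ≥ 4` the digamma term
is nonnegative. For `d = 2` the brace equals `1`, and for `d = 3` it is at least `7 - 8 log 2`. -/
theorem secondOrderConstant_pos {d : ℕ} (hd : 2 ≤ d) : 0 < secondOrderConstant d := by
  have hF := ballSphereRatio_pos hd
  have hlog := Real.log_two_lt_d9
  have hlog' := Real.log_two_gt_d9
  refine mul_pos hF ?_
  have hF2 : ballSphereRatio d ≤ 1 / 2 := by
    rw [ballSphereRatio_eq hd, div_le_iff₀ (by positivity)]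
    linarith [capConst_le hd]
  have hlF : Real.log (ballSphereRatio d) ≤ -Real.log 2 := by
    rw [← Real.log_inv, ← one_div]
    exact Real.log_le_log hF hF2
  change 0 < 1 - Real.log (ballSphereRatio d) + (d : ℝ) * (digammaGap d - Real.log 2)
  obtain rfl | rfl | h4 : d = 2 ∨ d = 3 ∨ 4 ≤ d := by omega
  · rw [digammaGap_two, ballSphereRatio_eq hd, capConst_two]
    have : Real.log (1 / 2 / ((2 : ℕ) : ℝ)) = -2 * Real.log 2 := by
      rw [show (1 / 2 / ((2 : ℕ) : ℝ)) = (2 ^ 2)⁻¹ by norm_num, Real.log_inv, Real.log_pow]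
      push_cast; ring
    rw [this]
    push_cast
    linarith
  · rw [digammaGap_three]
    push_cast
    linarith
  · obtain ⟨k, rfl⟩ := Nat.exists_eq_add_of_le' h4
    have := mul_nonneg (Nat.cast_nonneg (α := ℝ) (k + 4)) (sub_nonneg.2 (log_two_le_digammaGap k))
    linarith

/-! ### Lower bound for the mean of the mollified kernel -/

/-- The integrand `u^(m-1) (1-u)^(m-1) / (u+η)^m`. -/
noncomputable def mollifiedIntegrand (m η u : ℝ) : ℝ := (u * (1 - u) / (u + η)) ^ (m - 1) / (u + η)

theorem continuousOn_mollifiedIntegrand {m η : ℝ} (hm : 1 ≤ m) (hη : 0 < η) :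
    ContinuousOn (mollifiedIntegrand m η) (Set.Icc 0 1) := by
  have h : ∀ u ∈ Set.Icc (0 : ℝ) 1, u + η ≠ 0 := fun u hu => by linarith [hu.1]
  exact (ContinuousOn.rpow_const (ContinuousOn.div (by fun_prop) (by fun_prop) h)
    fun _ _ => Or.inr (by linarith)).div (by fun_prop) h

theorem le_integral_mollifiedIntegrand_one {η : ℝ} (hη : 0 < η) :
    -Real.log η ≤ ∫ u in (0 : ℝ)..1, mollifiedIntegrand 1 η u := by
  have h := intervalIntegral.sub_le_integral_of_hasDeriv_right_of_le zero_le_one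
    (g := fun u => Real.log (u + η)) (g' := fun u => 1 / (u + η)) (φ := mollifiedIntegrand 1 η)
    (ContinuousOn.log (by fun_prop) fun u hu => by linarith [hu.1])
    (fun u hu => (((hasDerivAt_id u).add_const η).log (by simp; linarith [hu.1])).hasDerivWithinAt)
    (continuousOn_mollifiedIntegrand le_rfl hη).integrableOn_Icc
    (fun u hu => by simp [mollifiedIntegrand])
  have : 0 ≤ Real.log (1 + η) := Real.log_nonneg (by linarith)
  simp only [zero_add] at h
  linarith

/-- The difference of the two integrands dominates the derivative of an explicit function, which
drops by at most `2 / m` over `[0, 1]`. -/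
theorem le_integral_mollifiedIntegrand_add_one {m η : ℝ} (hm : 1 ≤ m) (hη : 0 < η) :
    (∫ u in (0 : ℝ)..1, mollifiedIntegrand m η u) - 2 / m ≤
      ∫ u in (0 : ℝ)..1, mollifiedIntegrand (m + 1) η u := by
  have hm0 : 0 < m := by linarith
  have hc1 := continuousOn_mollifiedIntegrand hm hη
  have hc2 := continuousOn_mollifiedIntegrand (m := m + 1) (by linarith) hη
  have hi : ∀ {f : ℝ → ℝ}, ContinuousOn f (Set.Icc 0 1) → IntervalIntegrable f volume 0 1 :=
    fun hf => ContinuousOn.intervalIntegrable (by rwa [Set.uIcc_of_le zero_le_one])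
  have hne : ∀ u ∈ Set.Icc (0 : ℝ) 1, u + η ≠ 0 := fun u hu => by linarith [hu.1]
  have h := intervalIntegral.sub_le_integral_of_hasDeriv_right_of_le zero_le_one
    -- The first term comes from integration by parts and vanishes at both ends; the second absorbs
    -- the error caused by `η` and accounts for the loss.
    (g := fun u => (u * (1 - u) / (u + η)) ^ m / m - 2 / m * (u / (u + η)) ^ m)
    (g' := fun u => (((1 - 2 * u) * (u + η) - u * (1 - u)) / (u + η) ^ 2) * m *
        (u * (1 - u) / (u + η)) ^ (m - 1) / m -
      2 / m * ((η / (u + η) ^ 2) * m * (u / (u + η)) ^ (m - 1)))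
    (φ := fun u => mollifiedIntegrand (m + 1) η u - mollifiedIntegrand m η u)
    ?_ ?_ (hc2.sub hc1).integrableOn_Icc ?_
  · rw [intervalIntegral.integral_sub (hi hc2) (hi hc1)] at h
    simp only [sub_self, mul_zero, zero_div, zero_mul, Real.zero_rpow hm0.ne',
      zero_sub] at h
    have h1 : (1 / (1 + η)) ^ m ≤ 1 :=
      Real.rpow_le_one (by positivity) (by rw [div_le_one (by linarith)]; linarith) hm0.le
    have h2 : 2 / m * (1 / (1 + η)) ^ m ≤ 2 / m * 1 := by gcongr
    linarith
  · exact ((ContinuousOn.rpow_const (ContinuousOn.div (by fun_prop) (by fun_prop) hne)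
      fun _ _ => Or.inr hm0.le).div_const _).sub ((ContinuousOn.rpow_const (ContinuousOn.div
        (by fun_prop) (by fun_prop) hne) fun _ _ => Or.inr hm0.le).const_mul _)
  · intro u hu
    have hu' : u + η ≠ 0 := by linarith [hu.1]
    have d1 : HasDerivAt (fun u => u + η) 1 u := (hasDerivAt_id u).add_const η
    have d2 : HasDerivAt (fun u : ℝ => u * (1 - u)) (1 - 2 * u) u :=
      ((hasDerivAt_id u).mul ((hasDerivAt_id u).const_sub 1)).congr_deriv (by simp; ring)
    have d3 := ((d2.div d1 hu').rpow_const (p := m) (Or.inr hm)).div_const m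
    have d4 := (((hasDerivAt_id u).div d1 hu').rpow_const (p := m) (Or.inr hm)).const_mul (2 / m)
    refine HasDerivAt.hasDerivWithinAt ((d3.sub d4).congr_deriv ?_)
    simp
  · intro u hu
    have hu0 : 0 < u := hu.1
    have hu1 : 0 < 1 - u := by linarith [hu.2]
    have hs : 0 < u + η := by linarith
    have e1 : (u * (1 - u) / (u + η)) ^ (m - 1) = (u / (u + η)) ^ (m - 1) * (1 - u) ^ (m - 1) := by
      rw [← Real.mul_rpow (by positivity) hu1.le]; congr 1; ring
    have e2 : (u * (1 - u) / (u + η)) ^ (m + 1 - 1) =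
        (u / (u + η)) ^ (m - 1) * (1 - u) ^ (m - 1) * (u * (1 - u) / (u + η)) := by
      rw [← e1, add_sub_cancel_right]
      conv_rhs => rw [← Real.rpow_add_one (by positivity), sub_add_cancel]
    simp only [mollifiedIntegrand, e1, e2]
    set P := (u / (u + η)) ^ (m - 1)
    set Q := (1 - u) ^ (m - 1)
    have hP : 0 < P := Real.rpow_pos_of_pos (by positivity) _
    have hQ : Q ≤ 1 := Real.rpow_le_one hu1.le (by linarith) (by linarith)
    have hQ0 : 0 < Q := Real.rpow_pos_of_pos hu1 _
    have key : P * Q * (u * (1 - u) / (u + η)) / (u + η) - P * Q / (u + η) -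
        ((((1 - 2 * u) * (u + η) - u * (1 - u)) / (u + η) ^ 2) * m * (P * Q) / m -
          2 / m * ((η / (u + η) ^ 2) * m * P)) = 2 * η * P * (1 - Q * (1 - u)) / (u + η) ^ 2 := by
      field_simp
      ring
    have : 0 ≤ 2 * η * P * (1 - Q * (1 - u)) / (u + η) ^ 2 := by
      have : 0 ≤ 1 - Q * (1 - u) := by nlinarith
      positivity
    linarith

/-- Replacing `√(1 - u)` by `1` leaves `√u / (u + η)^(3/2)`, which has an elementary antiderivative.
The replacement changes the integrand by at most `1 / (1 + √(1 - u))`, because `u ≤ u + η`. -/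
theorem le_integral_mollifiedIntegrand_three_halves {η : ℝ} (hη : 0 < η) :
    -Real.log η - 2 * (2 - 2 * Real.log 2) ≤
      ∫ u in (0 : ℝ)..1, mollifiedIntegrand (3 / 2) η u := by
  have hsq : ∀ u : ℝ, 0 ≤ u → 0 < √(u + η) := fun u hu => Real.sqrt_pos.2 (by linarith)
  have h := intervalIntegral.sub_le_integral_of_hasDeriv_right_of_le zero_le_one
    (g := fun u => 2 * Real.log (√u + √(u + η)) - 2 * (√u / √(u + η)) +
      (2 * √(1 - u) - 2 * Real.log (1 + √(1 - u))))
    (g' := fun u => √u / √(u + η) ^ 3 - 1 / (1 + √(1 - u)))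
    (φ := mollifiedIntegrand (3 / 2) η) ?_ ?_
    (continuousOn_mollifiedIntegrand (by norm_num) hη).integrableOn_Icc ?_
  · have h1 : 1 ≤ √(1 + η) := Real.one_le_sqrt.2 (by linarith)
    have h2 : Real.log 2 ≤ Real.log (1 + √(1 + η)) := Real.log_le_log (by norm_num) (by linarith)
    have h3 : 1 / √(1 + η) ≤ 1 := by rw [div_le_one (by linarith)]; exact h1
    norm_num [Real.log_sqrt hη.le] at h h3 ⊢
    linarith
  · refine ContinuousOn.add (ContinuousOn.sub (ContinuousOn.const_mul (ContinuousOn.log (by fun_prop)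
      fun u hu => ?_) _) (ContinuousOn.const_mul (ContinuousOn.div (by fun_prop) (by fun_prop)
      fun u hu => (hsq u hu.1).ne') _)) (ContinuousOn.sub (by fun_prop) (ContinuousOn.const_mul
      (ContinuousOn.log (by fun_prop) fun u hu => ?_) _))
    · have := hsq u hu.1; positivity
    · positivity
  · intro u hu
    have hu1 : 0 < 1 - u := by linarith [hu.2]
    have hs : 0 < u + η := by linarith [hu.1]
    have a1 := (hasDerivAt_id u).sqrt hu.1.ne'
    have a2 := ((hasDerivAt_id u).add_const η).sqrt hs.ne'
    have a3 := ((hasDerivAt_id u).const_sub 1).sqrt hu1.ne'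
    simp only [id] at a1 a2 a3
    have p1 : 0 < √u := Real.sqrt_pos.2 hu.1
    have p2 : 0 < √(u + η) := Real.sqrt_pos.2 hs
    have p3 : 0 < √(1 - u) := Real.sqrt_pos.2 hu1
    have b1 := ((a1.add a2).log (by simp only [Pi.add_apply]; positivity)).const_mul 2
    have b2 := (a1.div a2 p2.ne').const_mul 2
    have b3 := (a3.const_mul 2).sub (((a3.const_add 1).log (by positivity)).const_mul 2)
    refine HasDerivAt.hasDerivWithinAt (((b1.sub b2).add b3).congr_deriv ?_)
    simp only [Pi.add_apply]
    have q1 : √u ^ 2 = u := Real.sq_sqrt hu.1.le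
    have q2 : √(u + η) ^ 2 = u + η := Real.sq_sqrt hs.le
    set x := √u
    set y := √(u + η)
    set z := √(1 - u)
    have e1 : 2 * ((1 / (2 * x) + 1 / (2 * y)) / (x + y)) = 1 / (x * y) := by field_simp; ring
    have e2 : 2 * ((1 / (2 * x) * y - x * (1 / (2 * y))) / y ^ 2) = 1 / (x * y) - x / y ^ 3 := by
      field_simp
    have e3 : 2 * (-1 / (2 * z)) - 2 * (-1 / (2 * z) / (1 + z)) = -(1 / (1 + z)) := by
      field_simp; ring
    rw [e1, e2, e3]
    ring
  · intro u hu
    have hu1 : 0 < 1 - u := by linarith [hu.2]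
    have hs : 0 < u + η := by linarith [hu.1]
    have p1 : 0 < √u := Real.sqrt_pos.2 hu.1
    have p2 : 0 < √(u + η) := Real.sqrt_pos.2 hs
    have p3 : 0 < √(1 - u) := Real.sqrt_pos.2 hu1
    have q1 : √u ^ 2 = u := Real.sq_sqrt hu.1.le
    have q2 : √(u + η) ^ 2 = u + η := Real.sq_sqrt hs.le
    have q3 : √(1 - u) ^ 2 = 1 - u := Real.sq_sqrt hu1.le
    have e1 : mollifiedIntegrand (3 / 2) η u = √u * √(1 - u) / √(u + η) ^ 3 := by
      rw [mollifiedIntegrand, show (3 / 2 - 1 : ℝ) = 1 / 2 by norm_num, ← Real.sqrt_eq_rpow,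
        Real.sqrt_div (mul_nonneg hu.1.le hu1.le), Real.sqrt_mul hu.1.le]
      conv_lhs => rw [← q2]
      rw [Real.sqrt_sq p2.le]
      field_simp
    rw [e1]
    have hxy : √u ≤ √(u + η) := Real.sqrt_le_sqrt (by linarith)
    have q4 : u = 1 - √(1 - u) ^ 2 := by linarith
    set x := √u
    set y := √(u + η)
    set z := √(1 - u)
    have h3 : x ^ 3 ≤ y ^ 3 := by gcongr
    rw [← sub_nonneg]
    have key : x * z / y ^ 3 - (x / y ^ 3 - 1 / (1 + z)) =
        (y ^ 3 - x * (1 - z ^ 2)) / (y ^ 3 * (1 + z)) := by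
      field_simp; ring
    rw [key, ← q4, ← q1]
    refine div_nonneg ?_ (by positivity)
    nlinarith

/-- With `m = d/2`, the loss `2 / m` from `m` to `m + 1` is exactly twice the increment `2 / d` of
`digammaGap`. Induction in steps of two thus reduces to `d = 2` and `d = 3`. -/
theorem le_integral_mollifiedIntegrand {d : ℕ} (hd : 2 ≤ d) {η : ℝ} (hη : 0 < η) :
    -Real.log η - 2 * digammaGap d ≤ ∫ u in (0 : ℝ)..1, mollifiedIntegrand (d / 2) η u := by
  obtain ⟨k, rfl⟩ := Nat.exists_eq_add_of_le' hd
  induction k using Nat.twoStepInduction with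
  | zero => simpa [digammaGap_two] using le_integral_mollifiedIntegrand_one hη
  | one => simpa [digammaGap_three] using le_integral_mollifiedIntegrand_three_halves hη
  | more k h _ =>
    have h1 := h (by omega)
    have hk : (0 : ℝ) ≤ k := Nat.cast_nonneg k
    have h2 := le_integral_mollifiedIntegrand_add_one (m := ((k + 2 : ℕ) : ℝ) / 2)
      (by push_cast; linarith) hη
    rw [digammaGap_add_two (by omega)]
    rw [show ((k + 2 + 2 : ℕ) : ℝ) / 2 = ((k + 2 : ℕ) : ℝ) / 2 + 1 by push_cast; ring]
    have h3 : 2 / (((k + 2 : ℕ) : ℝ) / 2) = 2 * (2 / ((k + 2 : ℕ) : ℝ)) := by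
      rw [div_div_eq_mul_div]; ring
    linarith

/-! ### Positive definiteness of the mollified kernel -/

theorem inner_pow_eq_sum {n : ℕ} {ι : Type*} [Fintype ι] (x y : EuclideanSpace ℝ ι) :
    (inner ℝ x y) ^ n = ∑ i : Fin n → ι, (∏ k, x (i k)) * ∏ k, y (i k) := by
  classical
  have : inner ℝ x y = ∑ j, x j * y j := by
    rw [PiLp.inner_apply]
    exact Finset.sum_congr rfl fun j _ => by simp [mul_comm]
  rw [this, Finset.sum_pow', Fintype.piFinset_univ]
  exact Finset.sum_congr rfl fun i _ => Finset.prod_mul_distrib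

theorem ae_norm_eq_one_sphereMeasure (d : ℕ) : ∀ᵐ p ∂sphereMeasure d, ‖p‖ = 1 := by
  have : ∀ᵐ p ∂sphereMeasure d, p ∈ unitSphere d := sphereMeasure_compl_unitSphere d
  filter_upwards [this] with p hp using norm_of_mem_unitSphere hp

theorem integrable_prod_coord {d : ℕ} (hd : 2 ≤ d) {n : ℕ} (i : Fin n → Fin (d + 1)) :
    Integrable (fun y : EuclideanSpace ℝ (Fin (d + 1)) => ∏ k, y (i k)) (sphereMeasure d) := by
  have := isProbabilityMeasure_sphereMeasure hd
  refine Integrable.of_bound (C := 1) (by fun_prop) ?_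
  filter_upwards [ae_norm_eq_one_sphereMeasure d] with y hy
  rw [norm_prod]
  exact Finset.prod_le_one (fun _ _ => norm_nonneg _) fun k _ => (PiLp.norm_apply_le y (i k)).trans hy.le

/-- `⟪x, y⟫^n` is the inner product of the tensor powers of `x` and `y`. With `W` the mean tensor
power over the sphere, the claim expands the squared norm of `∑ x_j^(⊗n) - N W`. Both `⟪W, p^(⊗n)⟫`,
for unit `p`, and `‖W‖²` equal the `n`-th height moment. -/
theorem sq_mul_integral_pow_le_sum {d : ℕ} (hd : 2 ≤ d) (n : ℕ) {N : ℕ}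
    (x : Fin N → EuclideanSpace ℝ (Fin (d + 1))) (hx : ∀ j, ‖x j‖ = 1) :
    (N : ℝ) ^ 2 * ∫ t, t ^ n ∂heightMeasure d ≤ ∑ j, ∑ k, (inner ℝ (x j) (x k)) ^ n := by
  have := isProbabilityMeasure_sphereMeasure hd
  set M := ∫ t, t ^ n ∂heightMeasure d
  set W : (Fin n → Fin (d + 1)) → ℝ := fun i => ∫ y, ∏ k, y (i k) ∂sphereMeasure d
  have hM : ∀ p : EuclideanSpace ℝ (Fin (d + 1)), ‖p‖ = 1 → ∑ i, W i * ∏ k, p (i k) = M := by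
    intro p hp
    simp only [M]
    rw [← integral_inner_sphereMeasure hd hp (f := fun t => t ^ n) (by fun_prop)]
    simp_rw [inner_pow_eq_sum]
    rw [integral_finsetSum _ fun i _ => (integrable_prod_coord hd i).mul_const _]
    simp_rw [integral_mul_const, W]
  have hWW : ∑ i, W i * W i = M := by
    calc ∑ i, W i * W i = ∑ i, ∫ y, W i * ∏ k, y (i k) ∂sphereMeasure d := by
          simp_rw [integral_const_mul, W]
      _ = ∫ y, ∑ i, W i * ∏ k, y (i k) ∂sphereMeasure d :=
          (integral_finsetSum _ fun i _ => (integrable_prod_coord hd i).const_mul _).symm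
      _ = ∫ _, M ∂sphereMeasure d := by
          refine integral_congr_ae ?_
          filter_upwards [ae_norm_eq_one_sphereMeasure d] with y hy using hM y hy
      _ = M := by simp
  have hsq : 0 ≤ ∑ i, ((∑ j, ∏ k, x j (i k)) - N * W i) ^ 2 :=
    Finset.sum_nonneg fun i _ => sq_nonneg _
  have hexp : ∑ i, ((∑ j, ∏ k, x j (i k)) - N * W i) ^ 2 =
      ∑ j, ∑ k, (inner ℝ (x j) (x k)) ^ n - 2 * N * (∑ j, ∑ i, W i * ∏ k, x j (i k)) +
        N ^ 2 * ∑ i, W i * W i := by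
    simp_rw [inner_pow_eq_sum]
    have h1 : ∑ j, ∑ k, ∑ i : Fin n → Fin (d + 1), (∏ l, x j (i l)) * ∏ l, x k (i l) =
        ∑ i : Fin n → Fin (d + 1), (∑ j, ∏ l, x j (i l)) * ∑ k, ∏ l, x k (i l) := by
      simp_rw [Finset.sum_mul_sum]
      rw [Finset.sum_comm]
      refine (Finset.sum_congr rfl fun k _ => Finset.sum_comm).trans ?_
      rw [Finset.sum_comm]
      exact Finset.sum_congr rfl fun i _ => Finset.sum_comm
    rw [h1, Finset.sum_comm (f := fun j i => W i * ∏ k, x j (i k)), Finset.mul_sum, Finset.mul_sum,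
      ← Finset.sum_sub_distrib, ← Finset.sum_add_distrib]
    refine Finset.sum_congr rfl fun i _ => ?_
    rw [← Finset.mul_sum]
    ring
  have hcross : ∑ j, ∑ i, W i * ∏ k, x j (i k) = N * M := by
    simp [hM _ (hx _)]
  rw [hexp, hcross, hWW] at hsq
  linarith

theorem ringChoose_nonneg {m : ℝ} (hm : 1 ≤ m) (n : ℕ) : 0 ≤ Ring.choose (m + n - 1) n := by
  have h := Ring.factorial_nsmul_multichoose_eq_ascPochhammer m n
  rw [Ring.multichoose_eq, Polynomial.ascPochhammer_smeval_eq_eval, nsmul_eq_mul] at h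
  have h2 := ascPochhammer_pos n m (by linarith)
  rw [← h] at h2
  exact (pos_of_mul_pos_right h2 (by positivity)).le

/-- Binomial series in `2t / A`; the condition `2 < A` puts all of `|t| ≤ 1` inside the disc of
convergence. -/
theorem hasSum_mollified {m A t : ℝ} (hA : 2 < A) (ht : |t| ≤ 1) :
    HasSum (fun n : ℕ => A ^ (-m) * (Ring.choose (m + n - 1) n * (2 / A) ^ n) * t ^ n)
      ((A - 2 * t) ^ (-m)) := by
  have hA0 : 0 < A := by linarith
  have hlt : |2 / A * t| < 1 := by
    rw [abs_mul, abs_of_pos (by positivity : 0 < 2 / A)]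
    have : 2 / A < 1 := by rw [div_lt_one hA0]; exact hA
    nlinarith [abs_nonneg t, (by positivity : 0 < 2 / A)]
  have h := (Real.one_div_one_sub_rpow_hasFPowerSeriesOnBall_zero m).hasSum (y := 2 / A * t) (by
    rw [Metric.mem_eball, edist_zero_right, Real.enorm_eq_ofReal_abs, ENNReal.ofReal_lt_one]
    exact hlt)
  simp only [zero_add, FormalMultilinearSeries.ofScalars_apply_eq] at h
  have h2 := h.mul_left (A ^ (-m))
  have h3 : (A - 2 * t) ^ (-m) = A ^ (-m) * (1 / (1 - 2 / A * t) ^ m) := by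
    rw [one_div, ← Real.rpow_neg (by linarith [le_abs_self (2 / A * t)]),
      ← Real.mul_rpow hA0.le (by linarith [le_abs_self (2 / A * t)])]
    congr 1
    field_simp
  rw [h3]
  have h4 : (fun n : ℕ => A ^ (-m) * (Ring.choose (m + n - 1) n * (2 / A) ^ n) * t ^ n) =
      fun n : ℕ => A ^ (-m) * (Ring.choose (m + n - 1) n • (2 / A * t) ^ n) := by
    ext n
    simp only [smul_eq_mul, mul_pow]
    ring
  rw [h4]
  exact h2

theorem abs_le_one_ae_heightMeasure (d : ℕ) : ∀ᵐ t ∂heightMeasure d, |t| ≤ 1 := by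
  refine (withDensity_absolutelyContinuous _ _).ae_le ?_
  filter_upwards [ae_restrict_mem measurableSet_Ioo] with t ht
  exact abs_le.2 ⟨ht.1.le, ht.2.le⟩

theorem sq_mul_integral_mollified_le_sum {d : ℕ} (hd : 2 ≤ d) {A : ℝ} (hA : 2 < A) {N : ℕ}
    (x : Fin N → EuclideanSpace ℝ (Fin (d + 1))) (hx : ∀ j, ‖x j‖ = 1) :
    (N : ℝ) ^ 2 * ∫ t, (A - 2 * t) ^ (-((d : ℝ) / 2)) ∂heightMeasure d ≤
      ∑ j, ∑ k, (A - 2 * inner ℝ (x j) (x k)) ^ (-((d : ℝ) / 2)) := by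
  have := isProbabilityMeasure_heightMeasure hd
  set m := (d : ℝ) / 2
  have hm : 1 ≤ m := by have := half_sub_one_nonneg hd; simp only [m]; linarith
  set a : ℕ → ℝ := fun n => A ^ (-m) * (Ring.choose (m + n - 1) n * (2 / A) ^ n)
  have ha : ∀ n, 0 ≤ a n := fun n =>
    mul_nonneg (Real.rpow_nonneg (by linarith) _)
      (mul_nonneg (ringChoose_nonneg hm n) (pow_nonneg (div_nonneg zero_le_two (by linarith)) _))
  have hsum : Summable a := by
    simpa using (hasSum_mollified (m := m) hA (t := 1) (by simp)).summable
  have hbound : ∀ n, ∀ᵐ t ∂heightMeasure d, ‖a n * t ^ n‖ ≤ a n := fun n => by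
    filter_upwards [abs_le_one_ae_heightMeasure d] with t ht
    rw [norm_mul, norm_pow, Real.norm_eq_abs, Real.norm_eq_abs, abs_of_nonneg (ha n)]
    exact mul_le_of_le_one_right (ha n) (pow_le_one₀ (abs_nonneg _) ht)
  have h1 : HasSum (fun n => ∫ t, a n * t ^ n ∂heightMeasure d)
      (∫ t, (A - 2 * t) ^ (-m) ∂heightMeasure d) := by
    refine hasSum_integral_of_dominated_convergence (fun n _ => a n) (fun n => by fun_prop) hbound
      (Eventually.of_forall fun _ => hsum) (integrable_const _) ?_
    filter_upwards [abs_le_one_ae_heightMeasure d] with t ht using hasSum_mollified hA ht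
  have h2 : HasSum (fun n => ∑ j, ∑ k, a n * (inner ℝ (x j) (x k)) ^ n)
      (∑ j, ∑ k, (A - 2 * inner ℝ (x j) (x k)) ^ (-m)) :=
    hasSum_sum fun j _ => hasSum_sum fun k _ => hasSum_mollified hA (by
      simpa [hx] using abs_real_inner_le_norm (x j) (x k))
  refine hasSum_le (fun n => ?_) (h1.mul_left _) h2
  simp_rw [integral_const_mul, ← Finset.mul_sum]
  rw [mul_left_comm]
  exact mul_le_mul_of_nonneg_left (sq_mul_integral_pow_le_sum hd n x hx) (ha n)

/-- Substituting `t = 1 - 2u` gives `1 - t² = 4u(1 - u)` and `2 + ε - 2t = 4(u + ε/4)`; the powers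
of `4` and the Jacobian `2` combine to `1/2`. -/
theorem integral_mollified_eq {d : ℕ} (hd : 2 ≤ d) {ε : ℝ} (hε : 0 < ε) :
    ∫ t, (2 + ε - 2 * t) ^ (-((d : ℝ) / 2)) ∂heightMeasure d =
      capConst d / 2 * ∫ u in (0 : ℝ)..1, mollifiedIntegrand (d / 2) (ε / 4) u := by
  rw [integral_heightMeasure hd, ← integral_Ioc_eq_integral_Ioo,
    ← intervalIntegral.integral_of_le (by norm_num)]
  have hsub := intervalIntegral.integral_comp_sub_mul (a := 0) (b := 1) (c := 2)
    (fun t => capConst d * capWeight d t * (2 + ε - 2 * t) ^ (-((d : ℝ) / 2))) two_ne_zero 1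
  norm_num at hsub
  rw [eq_comm, ← mul_right_inj' (two_ne_zero (α := ℝ))] at hsub
  rw [show ∫ t in (-1 : ℝ)..1, capConst d * capWeight d t * (2 + ε - 2 * t) ^ (-((d : ℝ) / 2)) =
    2 * ∫ u in (0 : ℝ)..1, capConst d * capWeight d (1 - 2 * u) *
      (2 + ε - 2 * (1 - 2 * u)) ^ (-((d : ℝ) / 2)) by linarith,
    ← intervalIntegral.integral_const_mul, ← intervalIntegral.integral_const_mul]
  refine intervalIntegral.integral_congr fun u hu => ?_
  rw [Set.uIcc_of_le zero_le_one] at hu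
  have hs : 0 < u + ε / 4 := by linarith [hu.1]
  have hu2 : 0 ≤ u * (1 - u) := mul_nonneg hu.1 (by linarith [hu.2])
  simp only [capWeight, mollifiedIntegrand]
  rw [show 1 - (1 - 2 * u) ^ 2 = 4 * (u * (1 - u)) by ring,
    show 2 + ε - 2 * (1 - 2 * u) = 4 * (u + ε / 4) by ring, Real.mul_rpow (by norm_num) hu2,
    Real.mul_rpow (by norm_num) hs.le, Real.div_rpow hu2 hs.le, Real.rpow_neg (by norm_num),
    Real.rpow_neg hs.le, Real.rpow_sub_one (by norm_num) _, Real.rpow_sub_one hs.ne']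
  have h4 : (4 : ℝ) ^ ((d : ℝ) / 2) ≠ 0 := (Real.rpow_pos_of_pos (by norm_num) _).ne'
  have hs' : (u + ε / 4) ^ ((d : ℝ) / 2) ≠ 0 := (Real.rpow_pos_of_pos hs _).ne'
  have hs'' : u + ε / 4 ≠ 0 := hs.ne'
  set P := (u + ε / 4) ^ ((d : ℝ) / 2)
  set Q := (4 : ℝ) ^ ((d : ℝ) / 2)
  set R := (u * (1 - u)) ^ ((d : ℝ) / 2 - 1)
  set s := u + ε / 4
  field_simp
  norm_num
  left
  ring

/-! ### Lower bound for the energy -/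

theorem norm_sub_sq_of_norm_eq_one {E : Type*} [NormedAddCommGroup E] [InnerProductSpace ℝ E]
    {x y : E} (hx : ‖x‖ = 1) (hy : ‖y‖ = 1) : ‖x - y‖ ^ 2 = 2 - 2 * inner ℝ x y := by
  rw [norm_sub_sq_real, hx, hy]; ring

theorem inv_edist_rpow_eq {E : Type*} [NormedAddCommGroup E] [InnerProductSpace ℝ E]
    {x y : E} (hx : ‖x‖ = 1) (hy : ‖y‖ = 1) (hxy : x ≠ y) (s : ℝ) :
    (edist x y ^ s)⁻¹ = ENNReal.ofReal ((2 - 2 * inner ℝ x y) ^ (-(s / 2))) := by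
  have h : 0 < ‖x - y‖ := norm_pos_iff.2 (sub_ne_zero.2 hxy)
  rw [edist_dist, dist_eq_norm, ENNReal.ofReal_rpow_of_pos h, ← norm_sub_sq_of_norm_eq_one hx hy,
    ← Real.rpow_natCast, ← Real.rpow_mul h.le, ← ENNReal.ofReal_inv_of_pos (Real.rpow_pos_of_pos h _),
    ← Real.rpow_neg h.le]
  congr 2
  push_cast
  ring

theorem ofReal_mollified_le {E : Type*} [NormedAddCommGroup E] [InnerProductSpace ℝ E]
    {x y : E} (hx : ‖x‖ = 1) (hy : ‖y‖ = 1) {s ε : ℝ} (hs : 0 < s) (hε : 0 < ε) :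
    ENNReal.ofReal ((2 + ε - 2 * inner ℝ x y) ^ (-(s / 2))) ≤ (edist x y ^ s)⁻¹ := by
  by_cases hxy : x = y
  · simp [hxy, ENNReal.zero_rpow_of_pos hs]
  · rw [inv_edist_rpow_eq hx hy hxy]
    have h : 0 < ‖x - y‖ ^ 2 := pow_pos (norm_pos_iff.2 (sub_ne_zero.2 hxy)) 2
    rw [norm_sub_sq_of_norm_eq_one hx hy] at h
    exact ENNReal.ofReal_le_ofReal
      (Real.rpow_le_rpow_of_nonpos h (by linarith) (by linarith))

theorem ofReal_le_rieszEnergy {d : ℕ} (hd : 2 ≤ d) {N : ℕ} (hN : 0 < N)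
    (x : Fin N → EuclideanSpace ℝ (Fin (d + 1))) (hx : ∀ j, ‖x j‖ = 1) :
    ENNReal.ofReal (ballSphereRatio d * (N : ℝ) ^ 2 * Real.log N -
      secondOrderConstant d * (N : ℝ) ^ 2) ≤ rieszEnergy (d : ℝ) x := by
  have hF := ballSphereRatio_pos hd
  have hd0 : (0 : ℝ) < d := by positivity
  have hN0 : (0 : ℝ) < N := by exact_mod_cast hN
  set F := ballSphereRatio d with hFdef
  have hc : capConst d = d * F := by rw [hFdef, ballSphereRatio_eq hd]; field_simp
  set m := (d : ℝ) / 2 with hm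
  have hm0 : 0 < m := by positivity
  -- This choice maximizes `(d/2) F N² (-log ε) - N ε^(-d/2)`, the part of the bound depending on
  -- `ε`. The diagonal sum becomes `F N²`, which is the `1` in the brace of `c(d)`.
  set ε := (F * N) ^ (-(1 / m)) with hεdef
  have hFN : 0 < F * N := by positivity
  have hε : 0 < ε := Real.rpow_pos_of_pos hFN _
  have hεm : ε ^ (-m) = F * N := by
    rw [hεdef, ← Real.rpow_mul hFN.le, neg_mul_neg, one_div_mul_cancel hm0.ne', Real.rpow_one]
  have hlog : Real.log (ε / 4) = -(1 / m) * (Real.log F + Real.log N) - 2 * Real.log 2 := by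
    rw [Real.log_div hε.ne' (by norm_num), hεdef, Real.log_rpow hFN, Real.log_mul hF.ne' hN0.ne',
      show (4 : ℝ) = 2 ^ 2 by norm_num, Real.log_pow]
    push_cast; ring
  have hI := le_integral_mollifiedIntegrand hd (show 0 < ε / 4 by positivity)
  have hpd := sq_mul_integral_mollified_le_sum hd (show 2 < 2 + ε by linarith) x hx
  rw [integral_mollified_eq hd hε, hc] at hpd
  set K : Fin N × Fin N → ℝ := fun p => (2 + ε - 2 * inner ℝ (x p.1) (x p.2)) ^ (-m)
  have hsum : ∑ j, ∑ k, (2 + ε - 2 * inner ℝ (x j) (x k)) ^ (-m) =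
      N * (F * N) + ∑ p ∈ (Finset.univ : Finset (Fin N)).offDiag, K p := by
    rw [← Finset.sum_product' (f := fun j k => (2 + ε - 2 * inner ℝ (x j) (x k)) ^ (-m)),
      ← Finset.diag_union_offDiag, Finset.sum_union (Finset.disjoint_diag_offDiag _),
      Finset.sum_diag]
    congr 1
    have : ∀ j, (2 + ε - 2 * inner ℝ (x j) (x j)) ^ (-m) = F * N := fun j => by
      rw [real_inner_self_eq_norm_sq, hx, ← hεm]; norm_num
    simp only [this, Finset.sum_const, Finset.card_univ, Fintype.card_fin, nsmul_eq_mul]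
  rw [hsum] at hpd
  have hKE : ENNReal.ofReal (∑ p ∈ (Finset.univ : Finset (Fin N)).offDiag, K p) ≤
      rieszEnergy (d : ℝ) x := by
    rw [ENNReal.ofReal_sum_of_nonneg, rieszEnergy]
    · exact Finset.sum_le_sum fun p _ => ofReal_mollified_le (hx _) (hx _) hd0 hε
    · intro p _
      refine Real.rpow_nonneg ?_ _
      rw [show 2 + ε - 2 * inner ℝ (x p.1) (x p.2) = ‖x p.1 - x p.2‖ ^ 2 + ε by
        rw [norm_sub_sq_of_norm_eq_one (hx _) (hx _)]; ring]
      positivity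
  refine (ENNReal.ofReal_le_ofReal ?_).trans hKE
  have hsc : secondOrderConstant d =
      F * (1 - Real.log F + d * (digammaGap d - Real.log 2)) := rfl
  have h1 : (N : ℝ) ^ 2 * (d * F / 2 * (-Real.log (ε / 4) - 2 * digammaGap d)) ≤
      N * (F * N) + ∑ p ∈ (Finset.univ : Finset (Fin N)).offDiag, K p :=
    le_trans (by gcongr) hpd
  rw [hlog] at h1
  have h2 : (N : ℝ) ^ 2 * (d * F / 2 * (-(-(1 / m) * (Real.log F + Real.log N) - 2 * Real.log 2) -
      2 * digammaGap d)) = N ^ 2 * F * (Real.log F + Real.log N + d * Real.log 2 -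
      d * digammaGap d) := by
    rw [hm]; field_simp; ring
  rw [h2] at h1
  rw [hsc]
  linarith

/-! ### Upper bound by greedy choice of points -/

theorem sphereMeasure_ball_le {d : ℕ} (hd : 2 ≤ d) {p : EuclideanSpace ℝ (Fin (d + 1))}
    (hp : ‖p‖ = 1) {r : ℝ} (hr : 0 < r) (hr2 : r ≤ 2) :
    sphereMeasure d (Metric.ball p r) ≤ ENNReal.ofReal (ballSphereRatio d * r ^ d) := by
  have hm := half_sub_one_nonneg hd
  have hd0 : (0 : ℝ) < d := by positivity
  have ha : -1 ≤ 1 - r ^ 2 / 2 := by nlinarith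
  have ha1 : 1 - r ^ 2 / 2 ≤ 1 := by nlinarith
  have hsub : Set.Ioo (1 - r ^ 2 / 2) 1 ⊆ Set.Ioo (-1) 1 := Set.Ioo_subset_Ioo_left ha
  have hle : sphereMeasure d (Metric.ball p r) ≤
      sphereMeasure d {x | 1 - r ^ 2 / 2 < inner ℝ x p} := by
    refine measure_mono_ae ?_
    filter_upwards [ae_norm_eq_one_sphereMeasure d] with x hx hxr
    have h1 : ‖x - p‖ < r := by rwa [← dist_eq_norm]
    have h2 := norm_sub_sq_of_norm_eq_one hx hp
    have h3 : ‖x - p‖ ^ 2 < r ^ 2 := by gcongr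
    change 1 - r ^ 2 / 2 < inner ℝ x p
    linarith
  refine hle.trans ?_
  rw [sphereMeasure_cap_eq hd hp ha, ballSphereRatio_eq hd, div_mul_eq_mul_div, mul_div_assoc]
  refine ENNReal.ofReal_le_ofReal (mul_le_mul_of_nonneg_left ?_ (capConst_pos hd).le)
  have hc : Continuous fun t : ℝ => (2 * (1 - t)) ^ ((d : ℝ) / 2 - 1) :=
    Continuous.rpow_const (by fun_prop) fun _ => Or.inr hm
  calc ∫ t in Set.Ioo (1 - r ^ 2 / 2) 1, capWeight d t
      ≤ ∫ t in Set.Ioo (1 - r ^ 2 / 2) 1, (2 * (1 - t)) ^ ((d : ℝ) / 2 - 1) := by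
        refine setIntegral_mono_on ((integrableOn_capWeight hd).mono_set hsub)
          (hc.integrableOn_Icc.mono_set Set.Ioo_subset_Icc_self) measurableSet_Ioo fun t ht => ?_
        have := hsub ht
        exact Real.rpow_le_rpow (by nlinarith [this.1, this.2]) (by nlinarith [this.2]) hm
    _ = ∫ t in (1 - r ^ 2 / 2)..1, (2 - 2 * t) ^ ((d : ℝ) / 2 - 1) := by
        rw [intervalIntegral.integral_of_le ha1, integral_Ioc_eq_integral_Ioo]
        simp only [mul_sub, mul_one]
    _ = r ^ d / d := by
        rw [intervalIntegral.integral_comp_sub_mul (fun t => t ^ ((d : ℝ) / 2 - 1)) two_ne_zero,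
          integral_rpow (Or.inl (by linarith)), sub_add_cancel,
          show (2 - 2 * (1 - r ^ 2 / 2) : ℝ) = r ^ 2 by ring, ← Real.rpow_natCast r 2,
          ← Real.rpow_mul hr.le, Nat.cast_ofNat, mul_div_cancel₀ _ (two_ne_zero (α := ℝ)),
          Real.rpow_natCast]
        norm_num
        rw [Real.zero_rpow (by positivity)]
        field_simp
        ring

/-- The bound `1 + t ≤ 2` reduces weight times kernel to `1 / (2(1 - t))`, whose integral up to `1 -
r²/2` is `log (2 / r)`. -/
theorem lintegral_compl_ball_le {d : ℕ} (hd : 2 ≤ d) {p : EuclideanSpace ℝ (Fin (d + 1))}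
    (hp : ‖p‖ = 1) {r : ℝ} (hr : 0 < r) (hr2 : r ≤ 2) :
    ∫⁻ y in (Metric.ball p r)ᶜ, (edist y p ^ (d : ℝ))⁻¹ ∂sphereMeasure d ≤
      ENNReal.ofReal (d * ballSphereRatio d * Real.log (2 / r)) := by
  have hm := half_sub_one_nonneg hd
  have hd0 : (0 : ℝ) < d := by positivity
  have hc := capConst_pos hd
  set a := 1 - r ^ 2 / 2 with ha
  have ha1 : -1 ≤ a := by nlinarith
  have ha2 : a < 1 := by nlinarith
  set f : ℝ → ℝ≥0∞ := (Set.Iic a).indicator fun t => ENNReal.ofReal ((2 - 2 * t) ^ (-((d : ℝ) / 2)))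
  have hf : Measurable f := (by fun_prop : Measurable _).indicator measurableSet_Iic
  have h1 : ∫⁻ y in (Metric.ball p r)ᶜ, (edist y p ^ (d : ℝ))⁻¹ ∂sphereMeasure d ≤
      ∫⁻ y, f (inner ℝ y p) ∂sphereMeasure d := by
    rw [← lintegral_indicator measurableSet_ball.compl]
    refine lintegral_mono_ae ?_
    filter_upwards [ae_norm_eq_one_sphereMeasure d] with y hy
    by_cases hyr : y ∈ (Metric.ball p r)ᶜ
    · have h2 : r ≤ ‖y - p‖ := by
        rw [← dist_eq_norm]; simpa using hyr
      have h3 : y ≠ p := by rintro rfl; simp at h2; linarith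
      have h4 : inner ℝ y p ∈ Set.Iic a := by
        have := norm_sub_sq_of_norm_eq_one hy hp
        have h5 : r ^ 2 ≤ ‖y - p‖ ^ 2 := by gcongr
        rw [Set.mem_Iic]; linarith
      rw [Set.indicator_of_mem hyr]
      simp only [f]
      rw [Set.indicator_of_mem h4, inv_edist_rpow_eq hy hp h3]
    · rw [Set.indicator_of_notMem hyr]; exact zero_le
  refine h1.trans ?_
  rw [lintegral_inner_sphereMeasure hd hp hf, lintegral_heightMeasure hd hf]
  have hcont : ContinuousOn (fun t : ℝ => capConst d / 2 * (1 - t)⁻¹) (Set.Icc (-1) a) :=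
    ContinuousOn.mul (by fun_prop) (ContinuousOn.inv₀ (by fun_prop) fun t ht => by linarith [ht.2])
  calc ∫⁻ t in Set.Ioo (-1) 1, ENNReal.ofReal (capConst d * capWeight d t) * f t
      = ∫⁻ t in Set.Ioo (-1) 1, (Set.Iic a).indicator (fun t => ENNReal.ofReal
          (capConst d * capWeight d t) * ENNReal.ofReal ((2 - 2 * t) ^ (-((d : ℝ) / 2)))) t := by
        refine lintegral_congr fun t => ?_
        by_cases ht : t ∈ Set.Iic a <;> simp [f, ht]
    _ = ∫⁻ t in Set.Ioc (-1) a, ENNReal.ofReal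
          (capConst d * capWeight d t) * ENNReal.ofReal ((2 - 2 * t) ^ (-((d : ℝ) / 2))) := by
        rw [setLIntegral_indicator measurableSet_Iic]
        congr 2
        ext t
        simp only [Set.mem_inter_iff, Set.mem_Iic, Set.mem_Ioo, Set.mem_Ioc]
        exact ⟨fun h => ⟨h.2.1, h.1⟩, fun h => ⟨h.2, h.1, by linarith⟩⟩
    _ ≤ ∫⁻ t in Set.Ioc (-1) a, ENNReal.ofReal (capConst d / 2 * (1 - t)⁻¹) := by
        refine setLIntegral_mono' measurableSet_Ioc fun t ht => ?_
        have ht1 : 0 < 1 - t := by linarith [ht.2]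
        have ht2 : 0 < 1 + t := by linarith [ht.1]
        have hw := capWeight_pos (d := d) (t := t) ⟨ht.1, by linarith⟩
        rw [← ENNReal.ofReal_mul (by positivity)]
        refine ENNReal.ofReal_le_ofReal ?_
        rw [mul_assoc, div_mul_eq_mul_div, mul_div_assoc]
        refine mul_le_mul_of_nonneg_left ?_ hc.le
        have e1 : capWeight d t = (1 - t) ^ ((d : ℝ) / 2 - 1) * (1 + t) ^ ((d : ℝ) / 2 - 1) := by
          rw [capWeight, ← Real.mul_rpow ht1.le ht2.le]; congr 1; ring
        have e2 : (2 - 2 * t) ^ (-((d : ℝ) / 2)) =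
            (2 : ℝ) ^ (-((d : ℝ) / 2)) * (1 - t) ^ (-((d : ℝ) / 2)) := by
          rw [← Real.mul_rpow (by norm_num) ht1.le]; congr 1; ring
        have e3 : (1 - t) ^ ((d : ℝ) / 2 - 1) * (1 - t) ^ (-((d : ℝ) / 2)) = (1 - t)⁻¹ := by
          rw [← Real.rpow_add ht1, ← Real.rpow_neg_one]; congr 1; ring
        have e4 : (1 + t) ^ ((d : ℝ) / 2 - 1) ≤ 2 ^ ((d : ℝ) / 2 - 1) :=
          Real.rpow_le_rpow ht2.le (by linarith) hm
        have e5 : (2 : ℝ) ^ ((d : ℝ) / 2 - 1) * (2 : ℝ) ^ (-((d : ℝ) / 2)) = 1 / 2 := by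
          rw [← Real.rpow_add two_pos, one_div, ← Real.rpow_neg_one]; congr 1; ring
        calc capWeight d t * (2 - 2 * t) ^ (-((d : ℝ) / 2))
            = (1 - t)⁻¹ * ((1 + t) ^ ((d : ℝ) / 2 - 1) * (2 : ℝ) ^ (-((d : ℝ) / 2))) := by
              rw [e1, e2, ← e3]; ring
          _ ≤ (1 - t)⁻¹ * (2 ^ ((d : ℝ) / 2 - 1) * (2 : ℝ) ^ (-((d : ℝ) / 2))) := by gcongr
          _ = (1 - t)⁻¹ / 2 := by rw [e5]; ring
    _ = ENNReal.ofReal (∫ t in Set.Ioc (-1) a, capConst d / 2 * (1 - t)⁻¹) := by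
        rw [ofReal_integral_eq_lintegral_ofReal]
        · exact (hcont.integrableOn_Icc).mono_set Set.Ioc_subset_Icc_self
        · filter_upwards [ae_restrict_mem measurableSet_Ioc] with t ht
          have ht1 : 0 < 1 - t := by linarith [ht.2]
          exact mul_nonneg (by positivity) (by positivity)
    _ ≤ _ := by
        refine ENNReal.ofReal_le_ofReal (le_of_eq ?_)
        rw [← intervalIntegral.integral_of_le ha1, intervalIntegral.integral_const_mul,
          intervalIntegral.integral_comp_sub_left (fun t => t⁻¹), integral_inv_of_pos (by linarith)
          (by norm_num), ballSphereRatio_eq hd, mul_div_cancel₀ _ hd0.ne',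
          show (1 - -1) / (1 - a) = (2 / r) ^ 2 by rw [ha]; field_simp; ring, Real.log_pow]
        push_cast
        ring

theorem exists_sum_inv_edist_le {d : ℕ} (hd : 2 ≤ d) {n : ℕ}
    (x : Fin n → EuclideanSpace ℝ (Fin (d + 1))) (hx : ∀ j, ‖x j‖ = 1) {r δ : ℝ} (hr : 0 < r)
    (hr2 : r ≤ 2) (hδ : δ < 1) (hnδ : n * (ballSphereRatio d * r ^ d) ≤ δ) :
    ∃ y ∈ unitSphere d, ∑ k, (edist y (x k) ^ (d : ℝ))⁻¹ ≤
      n * ENNReal.ofReal (d * ballSphereRatio d * Real.log (2 / r) / (1 - δ)) := by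
  have := isProbabilityMeasure_sphereMeasure hd
  have hF := ballSphereRatio_pos hd
  set T := d * ballSphereRatio d * Real.log (2 / r)
  -- Excluding the null complement of the sphere as well forces the selected point to lie on the
  -- sphere.
  set U := (unitSphere d)ᶜ ∪ ⋃ k, Metric.ball (x k) r
  have hUm : MeasurableSet U := (measurableSet_unitSphere d).compl.union
    (MeasurableSet.iUnion fun _ => measurableSet_ball)
  have hU : sphereMeasure d U ≤ ENNReal.ofReal δ :=
    calc sphereMeasure d U ≤ sphereMeasure d (unitSphere d)ᶜ +
          sphereMeasure d (⋃ k, Metric.ball (x k) r) := measure_union_le _ _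
      _ ≤ 0 + ∑ k, sphereMeasure d (Metric.ball (x k) r) :=
          add_le_add (sphereMeasure_compl_unitSphere d).le (measure_iUnion_fintype_le _ _)
      _ ≤ 0 + ∑ _k : Fin n, ENNReal.ofReal (ballSphereRatio d * r ^ d) := by
          gcongr with k _
          exact sphereMeasure_ball_le hd (hx k) hr hr2
      _ = ENNReal.ofReal (n * (ballSphereRatio d * r ^ d)) := by
          rw [zero_add, Finset.sum_const, Finset.card_univ, Fintype.card_fin, nsmul_eq_mul,
            ENNReal.ofReal_mul (Nat.cast_nonneg n), ENNReal.ofReal_natCast]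
      _ ≤ _ := ENNReal.ofReal_le_ofReal hnδ
  have hD : ENNReal.ofReal (1 - δ) ≤ sphereMeasure d Uᶜ := by
    have hδ0 : 0 ≤ δ := le_trans (by positivity) hnδ
    rw [prob_compl_eq_one_sub hUm, ENNReal.ofReal_sub _ hδ0, ENNReal.ofReal_one]
    exact tsub_le_tsub_left hU 1
  have hδ' : 0 < 1 - δ := by linarith
  have hD0 : sphereMeasure d Uᶜ ≠ 0 := (lt_of_lt_of_le (ENNReal.ofReal_pos.2 hδ') hD).ne'
  obtain ⟨y, hyU, hy⟩ := exists_le_setLAverage (f := fun y => ∑ k, (edist y (x k) ^ (d : ℝ))⁻¹)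
    hD0 (measure_ne_top _ _) (by fun_prop)
  refine ⟨y, by by_contra h; exact hyU (Or.inl h), hy.trans ?_⟩
  rw [setLAverage_eq]
  have hint : ∫⁻ y in Uᶜ, ∑ k, (edist y (x k) ^ (d : ℝ))⁻¹ ∂sphereMeasure d ≤
      n * ENNReal.ofReal T := by
    rw [lintegral_finsetSum _ fun k _ => by fun_prop]
    calc _ ≤ ∑ _k : Fin n, ENNReal.ofReal T := by
          refine Finset.sum_le_sum fun k _ => (lintegral_mono_set ?_).trans
            (lintegral_compl_ball_le hd (hx k) hr hr2)
          exact Set.compl_subset_compl.2 fun z hz => Or.inr (Set.mem_iUnion.2 ⟨k, hz⟩)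
      _ = _ := by simp
  rw [ENNReal.ofReal_div_of_pos hδ', ← mul_div_assoc]
  exact ENNReal.div_le_div hint hD

theorem rieszEnergy_eq_sum {X : Type*} [PseudoEMetricSpace X] (s : ℝ) {N : ℕ} (x : Fin N → X) :
    rieszEnergy s x = ∑ j, ∑ k, if j = k then 0 else (edist (x j) (x k) ^ s)⁻¹ := by
  rw [rieszEnergy,
    ← Finset.sum_product' (f := fun j k => if j = k then 0 else (edist (x j) (x k) ^ s)⁻¹),
    ← Finset.diag_union_offDiag, Finset.sum_union (Finset.disjoint_diag_offDiag _), Finset.sum_diag]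
  simp only [if_true, Finset.sum_const_zero, zero_add]
  exact Finset.sum_congr rfl fun p hp => (if_neg (Finset.mem_offDiag.1 hp).2.2).symm

theorem rieszEnergy_cons {X : Type*} [PseudoEMetricSpace X] (s : ℝ) {n : ℕ} (y : X)
    (x : Fin n → X) : rieszEnergy s (Fin.cons y x : Fin (n + 1) → X) =
      rieszEnergy s x + 2 * ∑ k, (edist y (x k) ^ s)⁻¹ := by
  rw [rieszEnergy_eq_sum, rieszEnergy_eq_sum]
  simp only [Fin.sum_univ_succ, Fin.cons_zero, Fin.cons_succ, Fin.succ_inj, Fin.succ_ne_zero,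
    (Fin.succ_ne_zero _).symm, if_true, if_false, zero_add, Finset.sum_add_distrib]
  simp_rw [edist_comm (x _) y]
  ring

theorem exists_rieszEnergy_le {d : ℕ} (hd : 2 ≤ d) {N : ℕ} {r δ : ℝ} (hr : 0 < r)
    (hr2 : r ≤ 2) (hδ : δ < 1) (hNδ : N * (ballSphereRatio d * r ^ d) ≤ δ) (n : ℕ) (hn : n ≤ N) :
    ∃ x : Fin n → EuclideanSpace ℝ (Fin (d + 1)), (∀ j, x j ∈ unitSphere d) ∧
      rieszEnergy (d : ℝ) x ≤
        (n : ℝ≥0∞) ^ 2 * ENNReal.ofReal (d * ballSphereRatio d * Real.log (2 / r) / (1 - δ)) := by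
  have hF := ballSphereRatio_pos hd
  set B := ENNReal.ofReal (d * ballSphereRatio d * Real.log (2 / r) / (1 - δ))
  induction n with
  | zero => exact ⟨fun i => i.elim0, fun i => i.elim0, by simp [rieszEnergy]⟩
  | succ n ih =>
    obtain ⟨x, hx, hE⟩ := ih (by omega)
    obtain ⟨y, hy, hyE⟩ := exists_sum_inv_edist_le hd x (fun j => norm_of_mem_unitSphere (hx j))
      hr hr2 hδ (le_trans (by gcongr; omega) hNδ)
    refine ⟨Fin.cons y x, fun j => Fin.cases hy hx j, ?_⟩
    rw [rieszEnergy_cons]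
    calc _ ≤ (n : ℝ≥0∞) ^ 2 * B + 2 * (n * B) := by gcongr
      -- The spare `B` completes the square `(n + 1)² B`.
      _ ≤ (n : ℝ≥0∞) ^ 2 * B + 2 * (n * B) + B := le_self_add
      _ = _ := by push_cast; ring

/-! ### Finiteness, attainment and the final estimates -/

theorem minRieszEnergy_le {d : ℕ} (hd : 2 ≤ d) {N : ℕ} {r δ : ℝ} (hr : 0 < r)
    (hr2 : r ≤ 2) (hδ : δ < 1) (hNδ : N * (ballSphereRatio d * r ^ d) ≤ δ) :
    minRieszEnergy (d : ℝ) (unitSphere d) N ≤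
      (N : ℝ≥0∞) ^ 2 * ENNReal.ofReal (d * ballSphereRatio d * Real.log (2 / r) / (1 - δ)) := by
  obtain ⟨x, hx, hE⟩ := exists_rieszEnergy_le hd hr hr2 hδ hNδ N le_rfl
  exact (iInf_le _ fun j => (⟨x j, hx j⟩ : unitSphere d)).trans hE

theorem minRieszEnergy_ne_top {d : ℕ} (hd : 2 ≤ d) (N : ℕ) :
    minRieszEnergy (d : ℝ) (unitSphere d) N ≠ ⊤ := by
  have hF := ballSphereRatio_pos hd
  have hd0 : (0 : ℝ) < d := by positivity
  have hpos : 0 < N * ballSphereRatio d + 1 := by positivity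
  set r := (N * ballSphereRatio d + 1) ^ (-(1 / (d : ℝ)))
  have hr : 0 < r := Real.rpow_pos_of_pos hpos _
  have hr1 : r ≤ 1 := Real.rpow_le_one_of_one_le_of_nonpos
    (by linarith [mul_nonneg (Nat.cast_nonneg (α := ℝ) N) hF.le]) (by simp)
  have hrd : r ^ d = (N * ballSphereRatio d + 1)⁻¹ := by
    rw [← Real.rpow_natCast, ← Real.rpow_mul hpos.le, neg_mul, one_div_mul_cancel hd0.ne',
      Real.rpow_neg_one]
  refine ne_top_of_le_ne_top ?_ (minRieszEnergy_le hd hr (by linarith)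
    (δ := N * (ballSphereRatio d * r ^ d)) ?_ le_rfl)
  · finiteness
  · rw [hrd, ← mul_assoc, ← div_eq_mul_inv, div_lt_one hpos]; linarith

/-- As a map into `[0, ∞]` the energy is continuous even at coinciding points, so compactness
applies directly. -/
theorem exists_rieszEnergy_eq_min {d : ℕ} (N : ℕ) : ∃ x : Fin N → unitSphere d,
    rieszEnergy (d : ℝ) (fun j => (x j : EuclideanSpace ℝ (Fin (d + 1)))) =
      minRieszEnergy (d : ℝ) (unitSphere d) N := by
  have : CompactSpace (unitSphere d) := isCompact_iff_compactSpace.1 (isCompact_unitSphere d)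
  have : Nonempty (unitSphere d) := by
    obtain ⟨p, hp⟩ := exists_norm_eq_one d
    exact ⟨⟨p, mem_sphere_zero_iff_norm.2 hp⟩⟩
  have hcont : Continuous fun x : Fin N → unitSphere d =>
      rieszEnergy (d : ℝ) (fun j => (x j : EuclideanSpace ℝ (Fin (d + 1)))) := by
    unfold rieszEnergy
    refine continuous_finsetSum _ fun p _ => continuous_inv.comp
      (ENNReal.continuous_rpow_const.comp ?_)
    exact Continuous.edist (by fun_prop) (by fun_prop)
  obtain ⟨x, -, hx⟩ := isCompact_univ.exists_isMinOn Set.univ_nonempty hcont.continuousOn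
  exact ⟨x, le_antisymm (le_iInf fun y => hx (Set.mem_univ y)) (iInf_le _ x)⟩

theorem minRieszEnergy_toReal_le {d : ℕ} (hd : 2 ≤ d) {N : ℕ} (hN : 1 ≤ Real.log N) :
    (minRieszEnergy (d : ℝ) (unitSphere d) N).toReal ≤
      ballSphereRatio d * (N : ℝ) ^ 2 * Real.log N +
        ballSphereRatio d * (N : ℝ) ^ 2 * Real.log (Real.log N) +
          (d * Real.log 2 + 2) * (N : ℝ) ^ 2 := by
  have hF := ballSphereRatio_pos hd
  have hd0 : (0 : ℝ) < d := by positivity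
  have hF2 : ballSphereRatio d ≤ 1 / 2 := by
    rw [ballSphereRatio_eq hd, div_le_iff₀ hd0]
    linarith [capConst_le hd]
  have hN1 : (1 : ℝ) ≤ N := by
    rcases Nat.eq_zero_or_pos N with h | h
    · simp [h] at hN; linarith
    · exact_mod_cast h
  set F := ballSphereRatio d
  set l := Real.log N
  have hl0 : 0 < l := by linarith
  have hpos : 0 < N * l := by positivity
  -- With `r^d = 1 / (N log N)` the excluded proportion is `δ = F / log N`. The factor `1 / (1 - δ)`
  -- then changes a quantity of order `log N` by `O(1)` only, while `-d log r` equals `log N + log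
  -- log N`.
  set r := (N * l) ^ (-(1 / (d : ℝ)))
  have hr : 0 < r := Real.rpow_pos_of_pos hpos _
  have hr1 : r ≤ 1 := Real.rpow_le_one_of_one_le_of_nonpos (by nlinarith) (by simp)
  have hrd : r ^ d = (N * l)⁻¹ := by
    rw [← Real.rpow_natCast, ← Real.rpow_mul hpos.le, neg_mul, one_div_mul_cancel hd0.ne',
      Real.rpow_neg_one]
  have hlogr : d * F * Real.log (2 / r) = F * (d * Real.log 2 + l + Real.log l) := by
    rw [Real.log_div two_ne_zero hr.ne', Real.log_rpow hpos, Real.log_mul (by linarith) hl0.ne']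
    field_simp
    ring
  have hx : F / l ≤ 1 / 2 := by rw [div_le_iff₀ hl0]; nlinarith
  have hx0 : 0 < F / l := by positivity
  have hmin := minRieszEnergy_le hd (N := N) hr (by linarith) (δ := F / l) (by linarith)
    (le_of_eq (by rw [hrd]; field_simp; rfl))
  rw [hlogr] at hmin
  have hll : 0 ≤ Real.log l := Real.log_nonneg hN
  have hll2 : Real.log l ≤ l := by linarith [Real.log_le_sub_one_of_pos hl0]
  have hlog2 : 0 < Real.log 2 := Real.log_pos (by norm_num)
  set T := F * (d * Real.log 2 + l + Real.log l)
  have hT0 : 0 ≤ T := by positivity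
  have h1 : T / (1 - F / l) ≤ F * l + F * Real.log l + (d * Real.log 2 + 2) := by
    have h2 : T / (1 - F / l) ≤ T * (1 + 2 * (F / l)) := by
      rw [div_le_iff₀ (by linarith), mul_assoc]
      refine le_mul_of_one_le_right hT0 ?_
      nlinarith
    have h3 : T * (2 * (F / l)) ≤ F * F * 2 * (d * Real.log 2 + 2) := by
      rw [← mul_div_assoc, ← mul_div_assoc, div_le_iff₀ hl0]
      have : d * Real.log 2 + l + Real.log l ≤ (d * Real.log 2 + 2) * l := by
        nlinarith [mul_pos hd0 hlog2]
      calc T * (2 * F) = F * F * 2 * (d * Real.log 2 + l + Real.log l) := by ring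
        _ ≤ F * F * 2 * ((d * Real.log 2 + 2) * l) := by gcongr
        _ = _ := by ring
    have h4 : F * F * 2 ≤ 1 / 2 := by nlinarith
    have h5 : F * F * 2 * (d * Real.log 2 + 2) ≤ 1 / 2 * (d * Real.log 2 + 2) := by gcongr
    have h6 : F * (d * Real.log 2) ≤ 1 / 2 * (d * Real.log 2) := by gcongr
    have h7 : T = F * (d * Real.log 2) + F * l + F * Real.log l := by simp only [T]; ring
    linarith
  have h8 := ENNReal.toReal_mono (by finiteness) hmin
  rw [ENNReal.toReal_mul, ENNReal.toReal_pow, ENNReal.toReal_natCast,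
    ENNReal.toReal_ofReal (div_nonneg hT0 (by linarith))] at h8
  have h9 : (N : ℝ) ^ 2 * (T / (1 - F / l)) ≤
      N ^ 2 * (F * l + F * Real.log l + (d * Real.log 2 + 2)) := by gcongr
  linarith

theorem le_minRieszEnergy_toReal {d : ℕ} (hd : 2 ≤ d) {N : ℕ} (hN : 0 < N) :
    ballSphereRatio d * (N : ℝ) ^ 2 * Real.log N - secondOrderConstant d * (N : ℝ) ^ 2 ≤
      (minRieszEnergy (d : ℝ) (unitSphere d) N).toReal :=
  (ENNReal.ofReal_le_iff_le_toReal (minRieszEnergy_ne_top hd N)).1 <| le_iInf fun x =>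
    ofReal_le_rieszEnergy hd hN _ fun j => norm_of_mem_unitSphere (x j).2

theorem mainTheorem1 (d : ℕ) (hd : 2 ≤ d) :
    (∀ N : ℕ, 2 ≤ N → ∃ x : Fin N → unitSphere d,
      rieszEnergy (d : ℝ) (fun j => (x j : EuclideanSpace ℝ (Fin (d + 1)))) =
          minRieszEnergy (d : ℝ) (unitSphere d) N ∧
        minRieszEnergy (d : ℝ) (unitSphere d) N ≠ ⊤) ∧
    0 < secondOrderConstant d ∧
    ∃ R₁ R₂ : ℕ → ℝ,
      R₁ =O[atTop] (fun N : ℕ => (N : ℝ) ^ (2 - 2 / (d : ℝ)) * Real.log (N : ℝ)) ∧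
      R₂ =O[atTop] (fun N : ℕ => (N : ℝ) ^ 2) ∧
      ∀ N : ℕ, 2 ≤ N →
        -secondOrderConstant d * (N : ℝ) ^ 2 + R₁ N ≤
            (minRieszEnergy (d : ℝ) (unitSphere d) N).toReal -
              ballSphereRatio d * (N : ℝ) ^ 2 * Real.log (N : ℝ) ∧
          (minRieszEnergy (d : ℝ) (unitSphere d) N).toReal -
              ballSphereRatio d * (N : ℝ) ^ 2 * Real.log (N : ℝ) ≤
            ballSphereRatio d * (N : ℝ) ^ 2 * Real.log (Real.log (N : ℝ)) + R₂ N := by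
  -- The lower estimate is exact, so `R₁ = 0`. Taking `R₂` as the positive part of the excess makes
  -- the upper inequality automatic for all `N ≥ 2`; only its growth for `log N ≥ 1` needs proof.
  refine ⟨fun N _ => ?_, secondOrderConstant_pos hd, fun _ => 0, fun N =>
    max 0 ((minRieszEnergy (d : ℝ) (unitSphere d) N).toReal -
      ballSphereRatio d * (N : ℝ) ^ 2 * Real.log N -
      ballSphereRatio d * (N : ℝ) ^ 2 * Real.log (Real.log N)), isBigO_zero _ _, ?_, fun N hN => ?_⟩
  · obtain ⟨x, hx⟩ := exists_rieszEnergy_eq_min (d := d) N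
    exact ⟨x, hx, minRieszEnergy_ne_top hd N⟩
  · refine IsBigO.of_bound (d * Real.log 2 + 2) ?_
    have hev : ∀ᶠ N : ℕ in atTop, 1 ≤ Real.log N :=
      (Real.tendsto_log_atTop.comp tendsto_natCast_atTop_atTop).eventually_ge_atTop 1
    filter_upwards [hev] with N hN
    have hlog2 : 0 < Real.log 2 := Real.log_pos (by norm_num)
    rw [Real.norm_of_nonneg (le_max_left _ _), Real.norm_of_nonneg (by positivity)]
    exact max_le (by positivity) (by linarith [minRieszEnergy_toReal_le hd hN])
  · have h1 := le_minRieszEnergy_toReal hd (N := N) (by omega)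
    have h2 := le_max_right 0 ((minRieszEnergy (d : ℝ) (unitSphere d) N).toReal -
      ballSphereRatio d * (N : ℝ) ^ 2 * Real.log N -
      ballSphereRatio d * (N : ℝ) ^ 2 * Real.log (Real.log N))
    constructor <;> linarith
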